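/- Let $T>0$, $\Omega_T=(0,1)\times(0,T)$, and let $H^{1/2}(0,T)$ be the space of measurable $h:(0,T)\to\mathbb C$ (modulo null sets) with $$\|h\|_{H^{1/2}(0,T)}^2=\int_0^T|h(t)|^2\,dt+\int_0^T\!\!\int_0^T\frac{|h(t)-h(s)|^2}{|t-s|^2}\,ds\,dt<\infty .$$ For $h\in H^{1/2}(0,T)$ and $t\in[0,T]$ put $$u_h(x,t)=\sum_{n=1}^{\infty}2in\pi\,e^{-i(n\pi)^2t}\int_0^t e^{i(n\pi)^2\tau}h(\tau)\,d\tau\;\sin n\pi x ,\qquad x\in(0,1),$$ the series being taken in $L^2(0,1)$. There is a constant $C_T$, depending only on $T$, such that for every $h\in H^{1/2}(0,T)$ the series converges in $L^2(0,1)$ for every $t\in[0,T]$, $$u_h\in L^4(\Omega_T)\cap C([0,T];L^2(0,1)),$$ $$\|u_h\|_{L^4(\Omega_T)}\le C_T\|h\|_{H^{1/2}(0,T)}\qquad\text{and}\qquad \sup_{0\le t\le T}\|u_h(\cdot,t)\|_{L^2(0,1)}\le C_T\|h\|_{H^{1/2}(0,T)} .$$ -/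

import Mathlib

open MeasureTheory Set
open scoped ENNReal NNReal

noncomputable section

/-- The Sobolev–Slobodeckij norm of `H^{1/2}(0,T)`, with values in `[0,∞]`:
`‖h‖² = ∫₀ᵀ |h(t)|² dt + ∫₀ᵀ ∫₀ᵀ |h(t) - h(s)|² / |t - s|² ds dt`
(the integrand of the double integral is `0` on the diagonal). -/
def eSobolevHalfNorm (T : ℝ) (h : ℝ → ℂ) : ℝ≥0∞ :=
  ((∫⁻ t in Ioo 0 T, ‖h t‖ₑ ^ 2) +
    ∫⁻ t in Ioo 0 T, ∫⁻ s in Ioo 0 T, ‖h t - h s‖ₑ ^ 2 / ‖t - s‖ₑ ^ 2) ^ (1 / 2 : ℝ)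

/-- `h ∈ H^{1/2}(0,T)`: `h` is (a.e. strongly) measurable on `(0,T)` and its norm is finite.
Only the restriction of `h` to `(0,T)`, up to null sets, matters. -/
def MemSobolevHalf (T : ℝ) (h : ℝ → ℂ) : Prop :=
  AEStronglyMeasurable h (volume.restrict (Ioo 0 T)) ∧ eSobolevHalfNorm T h < ∞

/-- The space `L²(0,1)` of complex-valued functions. -/
abbrev L2Unit : Type := Lp ℂ 2 (volume.restrict (Ioo (0 : ℝ) 1))

theorem memLp_sineMode (n : ℕ) :
    MemLp (fun x : ℝ => ((Real.sin (n * Real.pi * x) : ℝ) : ℂ)) 2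
      (volume.restrict (Ioo (0 : ℝ) 1)) := by
  refine MemLp.of_bound (Continuous.aestronglyMeasurable (by fun_prop)) 1 ?_
  filter_upwards with x
  rw [Complex.norm_real]
  exact Real.abs_sin_le_one _

/-- The function `x ↦ sin (nπx)` as an element of `L²(0,1)`. -/
def sineMode (n : ℕ) : L2Unit := (memLp_sineMode n).toLp _

/-- The coefficient `2 i n π e^{-i(nπ)²t} ∫₀ᵗ e^{i(nπ)²τ} h(τ) dτ`. -/
def boundaryCoeff (h : ℝ → ℂ) (n : ℕ) (t : ℝ) : ℂ :=
  2 * Complex.I * n * Real.pi * Complex.exp (-Complex.I * ((n * Real.pi : ℝ) : ℂ) ^ 2 * t) *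
    ∫ τ in (0 : ℝ)..t, Complex.exp (Complex.I * ((n * Real.pi : ℝ) : ℂ) ^ 2 * τ) * h τ

/-- The boundary integral `u_h(·,t) = (W_h h)(t) = ∑_{n ≥ 1} (boundaryCoeff h n t) sin (nπ·)`, the
series being taken in `L²(0,1)`; the term with `n = 0` is zero. -/
def boundaryIntegral (h : ℝ → ℂ) (t : ℝ) : L2Unit :=
  ∑' n : ℕ, boundaryCoeff h n t • sineMode n

end

/-!
Composing `h` with a tent function extends it evenly, and without jumps, to a circle. The
circumference is taken to be `P = 2M/π` with `M` an integer: then `(nπ)² = (2π/P) M n²`, so the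
exponentials `e^{-i(nπ)²t}` are characters of the circle. If `aₖ` are the Fourier coefficients of
the extension, `∑ₖ (1 + |k|) |aₖ|²` is controlled by `‖h‖²`, and the frequency `k` drives the
`n`-th sine mode with denominator `k + M n²`.

In `L⁴` the homogeneous part, the resonant part `k = -M n²` and the part with `M n² ≤ 2|k|` are
estimated by the periodic Strichartz inequality for the Schrödinger equation, the last one as a
superposition of free solutions, one for each value of `k + M n²`. When `2|k| < M n²` the
denominator gains two derivatives in `x`, and a Sobolev-type bound in `x` alone suffices. The
`L²` bounds follow from the orthogonality of the sines.
-/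

noncomputable section

section ENNReal

theorem ennreal_sq_rpow_half (x : ℝ≥0∞) : (x ^ 2) ^ (1 / 2 : ℝ) = x := by
  rw [← ENNReal.rpow_natCast, ← ENNReal.rpow_mul]
  norm_num

theorem ennreal_rpow_half_sq (x : ℝ≥0∞) : (x ^ (1 / 2 : ℝ)) ^ 2 = x := by
  rw [← ENNReal.rpow_natCast, ← ENNReal.rpow_mul]
  norm_num

theorem le_rpow_half_of_sq_le {x y : ℝ≥0∞} (h : x ^ 2 ≤ y) : x ≤ y ^ (1 / 2 : ℝ) := by
  simpa only [ennreal_sq_rpow_half] using ENNReal.rpow_le_rpow h (by norm_num : (0 : ℝ) ≤ 1 / 2)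

theorem ennreal_add_sq_le (x y : ℝ≥0∞) : (x + y) ^ 2 ≤ 2 * (x ^ 2 + y ^ 2) := by
  have h := ENNReal.rpow_add_le_mul_rpow_add_rpow x y (p := 2) (by norm_num)
  norm_num at h
  exact h

theorem inv_rpow_le_of_le_mul {x y A : ℝ≥0∞} {s : ℝ} (hs : 0 ≤ s) (hA₀ : A ≠ 0) (hA : A ≠ ∞)
    (h : x ≤ A * y) : (y ^ s)⁻¹ ≤ A ^ s * (x ^ s)⁻¹ := by
  calc (y ^ s)⁻¹ = A ^ s * ((A * y) ^ s)⁻¹ := by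
        rw [ENNReal.mul_rpow_of_nonneg _ _ hs, ENNReal.mul_inv, ← mul_assoc,
          ENNReal.mul_inv_cancel, one_mul]
        · exact (ENNReal.rpow_pos (pos_iff_ne_zero.2 hA₀) hA).ne'
        · exact ENNReal.rpow_ne_top_of_nonneg hs hA
        · exact .inl (ENNReal.rpow_pos (pos_iff_ne_zero.2 hA₀) hA).ne'
        · exact .inl (ENNReal.rpow_ne_top_of_nonneg hs hA)
    _ ≤ A ^ s * (x ^ s)⁻¹ := by gcongr

theorem tsum_mul_sq_le_tsum_sq_mul_tsum_sq {ι : Type*} (f g : ι → ℝ≥0∞) :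
    (∑' i, f i * g i) ^ 2 ≤ (∑' i, f i ^ 2) * ∑' i, g i ^ 2 := by
  let _ : MeasurableSpace ι := ⊤
  have h := ENNReal.lintegral_mul_le_Lp_mul_Lq (Measure.count : Measure ι)
    Real.HolderConjugate.two_two (f := f) (g := g)
    measurable_from_top.aemeasurable measurable_from_top.aemeasurable
  simp only [lintegral_count, Pi.mul_apply, ENNReal.rpow_ofNat] at h
  simpa only [mul_pow, ennreal_rpow_half_sq] using pow_le_pow_left₀ zero_le h 2

theorem tsum_sq_le_tsum_inv_mul_tsum {ι : Type*} {w : ι → ℝ≥0∞} (hw₀ : ∀ i, w i ≠ 0)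
    (hw : ∀ i, w i ≠ ∞) (f : ι → ℝ≥0∞) :
    (∑' i, f i) ^ 2 ≤ (∑' i, (w i)⁻¹) * ∑' i, w i * f i ^ 2 := by
  have h := tsum_mul_sq_le_tsum_sq_mul_tsum_sq (fun i => (w i)⁻¹ ^ (1 / 2 : ℝ))
    (fun i => w i ^ (1 / 2 : ℝ) * f i)
  have hcancel : ∀ i, (w i)⁻¹ ^ (1 / 2 : ℝ) * (w i ^ (1 / 2 : ℝ) * f i) = f i := fun i => by
    rw [← mul_assoc, ← ENNReal.mul_rpow_of_nonneg _ _ (by norm_num),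
      ENNReal.inv_mul_cancel (hw₀ i) (hw i), ENNReal.one_rpow, one_mul]
  simpa only [hcancel, mul_pow, ennreal_rpow_half_sq] using h

theorem sum_sq_le_sum_inv_mul_sum {ι : Type*} {w : ι → ℝ≥0∞} (hw₀ : ∀ i, w i ≠ 0)
    (hw : ∀ i, w i ≠ ∞) (s : Finset ι) (f : ι → ℝ≥0∞) :
    (∑ i ∈ s, f i) ^ 2 ≤ (∑ i ∈ s, (w i)⁻¹) * ∑ i ∈ s, w i * f i ^ 2 := by
  simpa only [← Finset.tsum_subtype] using
    tsum_sq_le_tsum_inv_mul_tsum (ι := s) (fun i => hw₀ i) (fun i => hw i) fun i => f i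

end ENNReal

section Bracket

/-- The weight `⟨k⟩ = 1 + |k|`, in which all decay rates of Fourier coefficients are measured. -/
def bracket (k : ℤ) : ℝ≥0∞ := ((k.natAbs + 1 : ℕ) : ℝ≥0∞)

theorem bracket_ne_zero (k : ℤ) : bracket k ≠ 0 := by
  simp [bracket]

theorem bracket_ne_top (k : ℤ) : bracket k ≠ ∞ := by
  simp [bracket]

theorem bracket_rpow_ne_zero (k : ℤ) (s : ℝ) : bracket k ^ s ≠ 0 :=
  (ENNReal.rpow_pos (pos_iff_ne_zero.2 (bracket_ne_zero k)) (bracket_ne_top k)).ne'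

theorem bracket_rpow_ne_top (k : ℤ) (s : ℝ) : bracket k ^ s ≠ ∞ :=
  ENNReal.rpow_ne_top_of_ne_zero (bracket_ne_zero k) (bracket_ne_top k)

theorem bracket_rpow_add (k : ℤ) (s t : ℝ) : bracket k ^ (s + t) = bracket k ^ s * bracket k ^ t :=
  ENNReal.rpow_add s t (bracket_ne_zero k) (bracket_ne_top k)

theorem tsum_inv_bracket_rpow_ne_top {s : ℝ} (hs : 1 < s) :
    ∑' k : ℤ, (bracket k ^ s)⁻¹ ≠ ∞ := by
  have hofReal : ∀ k : ℤ, (bracket k ^ s)⁻¹ = ENNReal.ofReal (((k.natAbs : ℝ) + 1) ^ (-s)) := by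
    intro k
    rw [← ENNReal.rpow_neg, ← ENNReal.ofReal_rpow_of_pos (by positivity), bracket,
      ← ENNReal.ofReal_natCast]
    push_cast
    rfl
  have hnat : Summable fun n : ℕ => ((n : ℝ) + 1) ^ (-s) := by
    simpa using (summable_nat_add_iff 1).2 (Real.summable_nat_rpow.2 (by linarith : -s < -1))
  have hint : Summable fun k : ℤ => ((k.natAbs : ℝ) + 1) ^ (-s) := by
    refine Summable.of_nat_of_neg ?_ ?_ <;> simpa using hnat
  simp only [hofReal, ← ENNReal.ofReal_tsum_of_nonneg (fun k : ℤ => by positivity) hint]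
  exact ENNReal.ofReal_ne_top

theorem tsum_natCast_le_tsum (f : ℤ → ℝ≥0∞) : ∑' n : ℕ, f n ≤ ∑' k, f k :=
  ENNReal.tsum_comp_le_tsum_of_injective Nat.cast_injective f

theorem sq_abs_sub_sqrt_le {M x y : ℝ} (hM : 1 ≤ M) (hx : 0 ≤ x) :
    |x - √(-y / M)| ^ 2 ≤ |y + M * x ^ 2| := by
  set r := √(-y / M)
  have hr : 0 ≤ r := Real.sqrt_nonneg _
  rcases le_total 0 y with hy | hy
  · have hr0 : r = 0 :=
      Real.sqrt_eq_zero_of_nonpos (div_nonpos_of_nonpos_of_nonneg (by linarith) (by linarith))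
    rw [hr0, sub_zero, sq_abs, abs_of_nonneg (by positivity)]
    nlinarith [sq_nonneg x]
  · have hfactor : y + M * x ^ 2 = M * ((x - r) * (x + r)) := by
      have hr2 : M * r ^ 2 = -y := by
        rw [Real.sq_sqrt (div_nonneg (by linarith) (by linarith))]
        field_simp
      linear_combination hr2
    have hsub : |x - r| ≤ x + r := abs_le.2 ⟨by linarith, by linarith⟩
    rw [hfactor, abs_mul, abs_mul, abs_of_nonneg (by linarith : 0 ≤ M),
      abs_of_nonneg (by linarith : 0 ≤ x + r), sq]
    calc |x - r| * |x - r| ≤ |x - r| * (x + r) := by gcongr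
      _ ≤ M * (|x - r| * (x + r)) := le_mul_of_one_le_left (by positivity) hM

theorem exists_bracket_sub_sq_le {M : ℕ} (hM : 0 < M) (k : ℤ) :
    ∃ m : ℤ, ∀ n : ℕ, bracket (n - m) ^ 2 ≤ 16 * bracket (k + M * n ^ 2) := by
  set r := √(-(k : ℝ) / M)
  refine ⟨⌊r⌋, fun n => ?_⟩
  have hdist : |(n : ℝ) - r| ^ 2 ≤ |(k : ℝ) + M * n ^ 2| :=
    sq_abs_sub_sqrt_le (by exact_mod_cast hM) n.cast_nonneg
  have hfloor : |(n : ℝ) - ⌊r⌋| ≤ |(n : ℝ) - r| + 1 := by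
    have := Int.floor_le r
    have := Int.lt_floor_add_one r
    refine (abs_sub_le _ r _).trans (add_le_add_right (abs_le.2 ⟨?_, ?_⟩) _) <;> linarith
  have hreal : (|(n : ℝ) - ⌊r⌋| + 1) ^ 2 ≤ 16 * (|(k : ℝ) + M * n ^ 2| + 1) := by
    nlinarith [sq_nonneg (|(n : ℝ) - r| - 1), abs_nonneg ((n : ℝ) - r),
      abs_nonneg ((n : ℝ) - ⌊r⌋)]
  have hnat : (((n : ℤ) - ⌊r⌋).natAbs + 1) ^ 2 ≤ 16 * ((k + M * n ^ 2 : ℤ).natAbs + 1) := by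
    have hcast : ∀ l : ℤ, ((l.natAbs : ℕ) : ℝ) = |(l : ℝ)| := fun l => by
      rw [Nat.cast_natAbs, Int.cast_abs]
    rw [← Nat.cast_le (α := ℝ)]
    push_cast [hcast]
    exact hreal
  unfold bracket
  exact_mod_cast hnat

/-- The values `k + M n²` separate quadratically from the one closest to `0`. -/
theorem exists_tsum_inv_bracket_quadratic_le {M : ℕ} (hM : 0 < M) : ∃ C : ℝ≥0, ∀ k : ℤ,
    ∑' n : ℕ, (bracket (k + M * n ^ 2) ^ (3 / 4 : ℝ))⁻¹ ≤ C := by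
  set S := ∑' k : ℤ, (bracket k ^ (3 / 2 : ℝ))⁻¹
  have hS : S ≠ ∞ := tsum_inv_bracket_rpow_ne_top (by norm_num)
  refine ⟨(16 ^ (3 / 4 : ℝ) * S).toNNReal, fun k => ?_⟩
  rw [ENNReal.coe_toNNReal (by finiteness)]
  obtain ⟨m, hm⟩ := exists_bracket_sub_sq_le hM k
  have hterm (n : ℕ) : (bracket (k + M * n ^ 2) ^ (3 / 4 : ℝ))⁻¹ ≤
      16 ^ (3 / 4 : ℝ) * (bracket (n - m) ^ (3 / 2 : ℝ))⁻¹ := by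
    convert inv_rpow_le_of_le_mul (by norm_num : (0 : ℝ) ≤ 3 / 4) (by norm_num) (by norm_num)
      (hm n) using 3
    rw [← ENNReal.rpow_natCast, ← ENNReal.rpow_mul]
    norm_num
  calc ∑' n : ℕ, (bracket (k + M * n ^ 2) ^ (3 / 4 : ℝ))⁻¹
      ≤ ∑' n : ℕ, 16 ^ (3 / 4 : ℝ) * (bracket (n - m) ^ (3 / 2 : ℝ))⁻¹ :=
        ENNReal.tsum_le_tsum hterm
    _ = 16 ^ (3 / 4 : ℝ) * ∑' n : ℕ, (bracket (n - m) ^ (3 / 2 : ℝ))⁻¹ := ENNReal.tsum_mul_left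
    _ ≤ 16 ^ (3 / 4 : ℝ) * ∑' l : ℤ, (bracket (l - m) ^ (3 / 2 : ℝ))⁻¹ := by
        gcongr
        exact tsum_natCast_le_tsum fun l => (bracket (l - m) ^ (3 / 2 : ℝ))⁻¹
    _ = 16 ^ (3 / 4 : ℝ) * S :=
        congrArg (16 ^ (3 / 4 : ℝ) * ·) <|
          (Equiv.subRight m).tsum_eq fun l => (bracket l ^ (3 / 2 : ℝ))⁻¹

end Bracket

section Characters

variable {X G : Type*} [MeasurableSpace X] [AddCommGroup G] {μ : Measure X}
  {E : X → AddChar G Circle}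

theorem integral_addChar_mul_conj (horth : ∀ g ≠ 0, ∫ x, (E x g : ℂ) ∂μ = 0) [DecidableEq G]
    (g h : G) :
    ∫ x, (E x g : ℂ) * (starRingEnd ℂ) (E x h) ∂μ = if g = h then (μ.real univ : ℂ) else 0 := by
  have hsub : ∀ x, (E x g : ℂ) * (starRingEnd ℂ) (E x h) = E x (g - h) := fun x => by
    rw [AddChar.map_sub_eq_div, Circle.coe_div, div_eq_mul_inv, ← Circle.coe_inv_eq_conj,
      Circle.coe_inv]
  simp only [hsub]
  split_ifs with hgh
  · simp [hgh]
  · exact horth _ (sub_ne_zero.2 hgh)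

variable [IsFiniteMeasure μ]

theorem integrable_sum_addChar (hE : ∀ g, AEStronglyMeasurable (fun x => (E x g : ℂ)) μ)
    (t : Finset G) (b : G → ℂ) : Integrable (fun x => ∑ g ∈ t, b g * E x g) μ :=
  integrable_finsetSum t fun g _ =>
    (Integrable.of_bound (hE g) 1 (.of_forall fun x => (Circle.norm_coe (E x g)).le)).const_mul _

theorem integral_norm_sum_addChar_sq
    (hE : ∀ g, AEStronglyMeasurable (fun x => (E x g : ℂ)) μ)
    (horth : ∀ g ≠ 0, ∫ x, (E x g : ℂ) ∂μ = 0) (t : Finset G) (b : G → ℂ) :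
    ∫ x, ‖∑ g ∈ t, b g * E x g‖ ^ 2 ∂μ = μ.real univ * ∑ g ∈ t, ‖b g‖ ^ 2 := by
  classical
  have hmul : ∀ g h, Integrable (fun x => (E x g : ℂ) * (starRingEnd ℂ) (E x h)) μ := fun g h =>
    Integrable.of_bound ((hE g).mul (Complex.continuous_conj.comp_aestronglyMeasurable (hE h))) 1
      (.of_forall fun x => by simp [Circle.norm_coe])
  have hexpand : ∀ x, ((‖∑ g ∈ t, b g * E x g‖ ^ 2 : ℝ) : ℂ) =
      ∑ g ∈ t, ∑ h ∈ t, b g * (starRingEnd ℂ) (b h) *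
        ((E x g : ℂ) * (starRingEnd ℂ) (E x h)) := fun x => by
    rw [← Complex.normSq_eq_norm_sq, ← Complex.mul_conj, map_sum, Finset.sum_mul_sum]
    simp only [map_mul, mul_mul_mul_comm]
  rw [← Complex.ofReal_inj, ← integral_complex_ofReal]
  simp only [hexpand]
  rw [integral_finsetSum _ fun g _ => integrable_finsetSum _ fun h _ => (hmul g h).const_mul _,
    Complex.ofReal_mul, Complex.ofReal_sum, Finset.mul_sum]
  refine Finset.sum_congr rfl fun g hg => ?_
  rw [integral_finsetSum _ fun h _ => (hmul g h).const_mul _]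
  simp only [integral_const_mul, integral_addChar_mul_conj horth, mul_ite, mul_zero,
    Finset.sum_ite_eq, if_pos hg, Complex.mul_conj, Complex.normSq_eq_norm_sq]
  exact mul_comm _ _

theorem lintegral_enorm_sum_addChar_sq
    (hE : ∀ g, AEStronglyMeasurable (fun x => (E x g : ℂ)) μ)
    (horth : ∀ g ≠ 0, ∫ x, (E x g : ℂ) ∂μ = 0) (t : Finset G) (b : G → ℂ) :
    ∫⁻ x, ‖∑ g ∈ t, b g * E x g‖ₑ ^ 2 ∂μ = μ univ * ∑ g ∈ t, ‖b g‖ₑ ^ 2 := by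
  have hbound : ∀ x, ‖‖∑ g ∈ t, b g * E x g‖ ^ 2‖ ≤ (∑ g ∈ t, ‖b g‖) ^ 2 := fun x => by
    rw [norm_pow, norm_norm]
    gcongr
    exact (norm_sum_le _ _).trans_eq (by simp [Circle.norm_coe])
  have hsq : Integrable (fun x => ‖∑ g ∈ t, b g * E x g‖ ^ 2) μ :=
    .of_bound ((integrable_sum_addChar hE t b).aestronglyMeasurable.norm.pow 2) _
      (.of_forall hbound)
  calc ∫⁻ x, ‖∑ g ∈ t, b g * E x g‖ₑ ^ 2 ∂μ
      = ENNReal.ofReal (∫ x, ‖∑ g ∈ t, b g * E x g‖ ^ 2 ∂μ) := by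
        rw [ofReal_integral_eq_lintegral_ofReal hsq (.of_forall fun x => by positivity)]
        simp only [ENNReal.ofReal_pow (norm_nonneg _), ofReal_norm]
    _ = μ univ * ∑ g ∈ t, ‖b g‖ₑ ^ 2 := by
        rw [integral_norm_sum_addChar_sq hE horth, ENNReal.ofReal_mul measureReal_nonneg,
          ofReal_measureReal, ENNReal.ofReal_sum_of_nonneg fun g _ => by positivity]
        simp only [ENNReal.ofReal_pow (norm_nonneg _), ofReal_norm]

theorem sum_addChar_sq {ι : Type*} [DecidableEq G] (e : AddChar G Circle) (s : Finset ι)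
    (γ : ι → G) (c : ι → ℂ) :
    (∑ n ∈ s, c n * (e (γ n) : ℂ)) ^ 2 =
      ∑ g ∈ (s ×ˢ s).image fun p => γ p.1 + γ p.2,
        (∑ p ∈ s ×ˢ s with γ p.1 + γ p.2 = g, c p.1 * c p.2) * (e g : ℂ) := by
  calc (∑ n ∈ s, c n * (e (γ n) : ℂ)) ^ 2
      = ∑ p ∈ s ×ˢ s, c p.1 * c p.2 * (e (γ p.1 + γ p.2) : ℂ) := by
        simp only [sq, Finset.sum_mul_sum, Finset.sum_product, AddChar.map_add_eq_mul,
          Circle.coe_mul, mul_mul_mul_comm]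
    _ = _ := by
        rw [← Finset.sum_fiberwise_of_maps_to fun p hp =>
          Finset.mem_image_of_mem (fun p : ι × ι => γ p.1 + γ p.2) hp]
        refine Finset.sum_congr rfl fun g _ => ?_
        rw [Finset.sum_mul]
        exact Finset.sum_congr rfl fun p hp => by rw [(Finset.mem_filter.1 hp).2]

/-- The square of a sum of characters is again one; `hK` controls how many frequencies collide. -/
theorem lintegral_enorm_sum_addChar_pow_four_le [DecidableEq G]
    (hE : ∀ g, AEStronglyMeasurable (fun x => (E x g : ℂ)) μ)
    (horth : ∀ g ≠ 0, ∫ x, (E x g : ℂ) ∂μ = 0) {ι : Type*} {s : Finset ι} {γ : ι → G}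
    {w : ι → ℝ≥0∞} (hw₀ : ∀ n, w n ≠ 0) (hw : ∀ n, w n ≠ ∞) {K : ℝ≥0∞}
    (hK : ∀ q ∈ s ×ˢ s,
      ∑ p ∈ s ×ˢ s with γ p.1 + γ p.2 = γ q.1 + γ q.2, (w p.1 * w p.2)⁻¹ ≤ K) (c : ι → ℂ) :
    ∫⁻ x, ‖∑ n ∈ s, c n * E x (γ n)‖ₑ ^ 4 ∂μ ≤
      μ univ * K * (∑ n ∈ s, w n * ‖c n‖ₑ ^ 2) ^ 2 := by
  set t := (s ×ˢ s).image fun p => γ p.1 + γ p.2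
  set b : G → ℂ := fun g => ∑ p ∈ s ×ˢ s with γ p.1 + γ p.2 = g, c p.1 * c p.2
  have hb : ∀ g ∈ t, ‖b g‖ₑ ^ 2 ≤ K * ∑ p ∈ s ×ˢ s with γ p.1 + γ p.2 = g,
      (w p.1 * ‖c p.1‖ₑ ^ 2) * (w p.2 * ‖c p.2‖ₑ ^ 2) := fun g hg => by
    obtain ⟨q, hq, rfl⟩ := Finset.mem_image.1 hg
    calc ‖b (γ q.1 + γ q.2)‖ₑ ^ 2
        ≤ (∑ p ∈ s ×ˢ s with γ p.1 + γ p.2 = γ q.1 + γ q.2, ‖c p.1 * c p.2‖ₑ) ^ 2 := by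
          gcongr
          exact enorm_sum_le _ _
      _ ≤ _ := sum_sq_le_sum_inv_mul_sum (fun p : ι × ι => mul_ne_zero (hw₀ p.1) (hw₀ p.2))
          (fun p => ENNReal.mul_ne_top (hw p.1) (hw p.2)) _ _
      _ ≤ _ := by
          simp only [enorm_mul, mul_pow, mul_mul_mul_comm (w _)]
          gcongr
          exact hK q hq
  calc ∫⁻ x, ‖∑ n ∈ s, c n * E x (γ n)‖ₑ ^ 4 ∂μ
      = ∫⁻ x, ‖∑ g ∈ t, b g * E x g‖ₑ ^ 2 ∂μ := by
        simp only [t, b, ← sum_addChar_sq, enorm_pow, ← pow_mul]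
    _ = μ univ * ∑ g ∈ t, ‖b g‖ₑ ^ 2 := lintegral_enorm_sum_addChar_sq hE horth t b
    _ ≤ μ univ * ∑ g ∈ t, K * ∑ p ∈ s ×ˢ s with γ p.1 + γ p.2 = g,
          (w p.1 * ‖c p.1‖ₑ ^ 2) * (w p.2 * ‖c p.2‖ₑ ^ 2) := by
        gcongr with g hg
        exact hb g hg
    _ = μ univ * K * (∑ n ∈ s, w n * ‖c n‖ₑ ^ 2) ^ 2 := by
        rw [← Finset.mul_sum,
          Finset.sum_fiberwise_of_maps_to fun p hp => Finset.mem_image_of_mem _ hp,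
          Finset.sum_product, sq, Finset.sum_mul_sum, mul_assoc]

theorem eLpNorm_sum_addChar_le [DecidableEq G]
    (hE : ∀ g, AEStronglyMeasurable (fun x => (E x g : ℂ)) μ)
    (horth : ∀ g ≠ 0, ∫ x, (E x g : ℂ) ∂μ = 0) {ι : Type*} {s : Finset ι} {γ : ι → G}
    {w : ι → ℝ≥0∞} (hw₀ : ∀ n, w n ≠ 0) (hw : ∀ n, w n ≠ ∞) {K : ℝ≥0∞}
    (hK : ∀ q ∈ s ×ˢ s,
      ∑ p ∈ s ×ˢ s with γ p.1 + γ p.2 = γ q.1 + γ q.2, (w p.1 * w p.2)⁻¹ ≤ K) (c : ι → ℂ) :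
    eLpNorm (fun x => ∑ n ∈ s, c n * E x (γ n)) 4 μ ≤
      (μ univ * K) ^ (1 / 4 : ℝ) * (∑ n ∈ s, w n * ‖c n‖ₑ ^ 2) ^ (1 / 2 : ℝ) := by
  rw [eLpNorm_eq_lintegral_rpow_enorm_toReal (by norm_num) (by norm_num)]
  simp only [ENNReal.toReal_ofNat, ENNReal.rpow_ofNat]
  refine (ENNReal.rpow_le_rpow
    (lintegral_enorm_sum_addChar_pow_four_le hE horth hw₀ hw hK c) (by norm_num)).trans_eq ?_
  rw [ENNReal.mul_rpow_of_nonneg _ _ (by norm_num), ← ENNReal.rpow_natCast, ← ENNReal.rpow_mul]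
  norm_num

end Characters

section Torus

variable {P : ℝ}

theorem norm_fourier_apply (k : ℤ) (x : AddCircle P) : ‖fourier k x‖ = 1 := by
  rw [fourier_apply, Circle.norm_coe]

theorem continuous_fourier_coe (k : ℤ) : Continuous fun t : ℝ => fourier k (t : AddCircle P) :=
  (fourier k).continuous.comp (AddCircle.continuous_mk' P)

/-- The character `(p, q) ↦ e^{πi p x} e^{2πi q t / P}` attached to the point `z = (x, t)` of the
torus `ℝ/2ℤ × ℝ/Pℤ`. -/
def torusChar (P : ℝ) (z : ℝ × ℝ) : AddChar (ℤ × ℤ) Circle where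
  toFun g := AddCircle.toCircle (g.1 • (z.1 : AddCircle (2 : ℝ))) *
    AddCircle.toCircle (g.2 • (z.2 : AddCircle P))
  map_zero_eq_one' := by simp
  map_add_eq_mul' g h := by
    simp only [Prod.fst_add, Prod.snd_add, add_zsmul, AddCircle.toCircle_add, mul_mul_mul_comm]

theorem coe_torusChar_apply (z : ℝ × ℝ) (g : ℤ × ℤ) :
    (torusChar P z g : ℂ) =
      fourier g.1 (z.1 : AddCircle (2 : ℝ)) * fourier g.2 (z.2 : AddCircle P) :=
  Circle.coe_mul _ _

theorem continuous_torusChar (g : ℤ × ℤ) : Continuous fun z => (torusChar P z g : ℂ) := by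
  simp only [coe_torusChar_apply]
  exact ((continuous_fourier_coe _).comp continuous_fst).mul
    ((continuous_fourier_coe _).comp continuous_snd)

/-- Lebesgue measure on the period cell `(0,2] × (0,P]` of the torus `ℝ/2ℤ × ℝ/Pℤ`. -/
def cellMeasure (P : ℝ) : Measure (ℝ × ℝ) :=
  (volume.restrict (Ioc (0 : ℝ) 2)).prod (volume.restrict (Ioc 0 P))

instance (P : ℝ) : IsFiniteMeasure (cellMeasure P) := by
  unfold cellMeasure
  infer_instance

theorem restrict_le_cellMeasure {T : ℝ} (hTP : T ≤ P) :
    (volume : Measure (ℝ × ℝ)).restrict (Ioo (0 : ℝ) 1 ×ˢ Ioo 0 T) ≤ cellMeasure P := by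
  rw [cellMeasure, Measure.prod_restrict, ← Measure.volume_eq_prod]
  refine Measure.restrict_mono (prod_mono ?_ ?_) le_rfl
  · exact fun x hx => ⟨hx.1, by linarith [hx.2]⟩
  · exact fun x hx => ⟨hx.1, hx.2.le.trans hTP⟩

theorem integral_fourier_period [hP : Fact (0 < P)] {k : ℤ} (hk : k ≠ 0) :
    ∫ t in Ioc 0 P, fourier k (t : AddCircle P) = 0 := by
  have h := fourierCoeff_eq_intervalIntegral (fourier k : AddCircle P → ℂ) 0 0
  rw [fourierCoeff_fourier, Pi.single_eq_of_ne hk.symm, zero_add,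
    intervalIntegral.integral_of_le hP.out.le] at h
  simpa [hP.out.ne'] using h

theorem integral_torusChar [Fact (0 < P)] {g : ℤ × ℤ} (hg : g ≠ 0) :
    ∫ z, (torusChar P z g : ℂ) ∂(cellMeasure P) = 0 := by
  have : Fact ((0 : ℝ) < 2) := ⟨two_pos⟩
  simp only [coe_torusChar_apply, cellMeasure]
  rw [integral_prod_mul (fun x : ℝ => fourier g.1 (x : AddCircle (2 : ℝ)))
    fun t : ℝ => fourier g.2 (t : AddCircle P), mul_eq_zero]
  by_cases h : g.1 = 0
  · exact .inr (integral_fourier_period fun h' => hg (Prod.ext h h'))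
  · exact .inl (integral_fourier_period h)

/-- The function `(x, t) ↦ sin (nπx) e^{2πi d t / P}`. -/
def sineWave (P : ℝ) (n : ℕ) (d : ℤ) (z : ℝ × ℝ) : ℂ :=
  (Real.sin (n * Real.pi * z.1) : ℂ) * fourier d (z.2 : AddCircle P)

theorem continuous_sineWave (n : ℕ) (d : ℤ) : Continuous (sineWave P n d) :=
  (by fun_prop : Continuous fun z : ℝ × ℝ => (Real.sin (n * Real.pi * z.1) : ℂ)).mul
    ((continuous_fourier_coe d).comp continuous_snd)

theorem sineWave_eq_sub (n : ℕ) (d : ℤ) (z : ℝ × ℝ) : sineWave P n d z =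
    (2 * Complex.I)⁻¹ * (torusChar P z (1 * n, d) - torusChar P z (-1 * n, d)) := by
  have hsin : (Real.sin (n * Real.pi * z.1) : ℂ) = (2 * Complex.I)⁻¹ *
      (fourier (1 * n) (z.1 : AddCircle (2 : ℝ)) - fourier (-1 * n) (z.1 : AddCircle (2 : ℝ))) := by
    rw [fourier_coe_apply, fourier_coe_apply, Complex.ofReal_sin, Complex.sin]
    field_simp
    push_cast
    ring_nf
    simp only [Complex.I_sq]
    ring_nf
  rw [coe_torusChar_apply, coe_torusChar_apply, ← sub_mul, ← mul_assoc, ← hsin, sineWave]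

/-- A sine is a difference of two characters, whose frequencies `±n` collide for the same pairs. -/
theorem eLpNorm_sum_sineWave_le [Fact (0 < P)] {s : Finset ℕ} {d : ℕ → ℤ} {w : ℕ → ℝ≥0∞}
    (hw₀ : ∀ n, w n ≠ 0) (hw : ∀ n, w n ≠ ∞) {K : ℝ≥0∞}
    (hK : ∀ q ∈ s ×ˢ s, ∑ p ∈ s ×ˢ s with p.1 + p.2 = q.1 + q.2 ∧ d p.1 + d p.2 = d q.1 + d q.2,
      (w p.1 * w p.2)⁻¹ ≤ K) (c : ℕ → ℂ) :
    eLpNorm (fun z => ∑ n ∈ s, c n * sineWave P n (d n) z) 4 (cellMeasure P) ≤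
      (cellMeasure P univ * K) ^ (1 / 4 : ℝ) * (∑ n ∈ s, w n * ‖c n‖ₑ ^ 2) ^ (1 / 2 : ℝ) := by
  set R := (cellMeasure P univ * K) ^ (1 / 4 : ℝ) * (∑ n ∈ s, w n * ‖c n‖ₑ ^ 2) ^ (1 / 2 : ℝ)
  set F : ℤ → ℝ × ℝ → ℂ := fun ε z => ∑ n ∈ s, c n * torusChar P z (ε * n, d n)
  have hmeas : ∀ ε, AEStronglyMeasurable (F ε) (cellMeasure P) := fun ε =>
    (continuous_finsetSum _ fun n _ =>
      continuous_const.mul (continuous_torusChar _)).aestronglyMeasurable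
  have hF : ∀ ε : ℤ, ε ≠ 0 → eLpNorm (F ε) 4 (cellMeasure P) ≤ R := fun ε hε => by
    refine eLpNorm_sum_addChar_le (γ := fun n : ℕ => (ε * (n : ℤ), d n))
      (fun g => (continuous_torusChar g).aestronglyMeasurable) (fun g => integral_torusChar)
      hw₀ hw (fun q hq => ?_) c
    simpa only [Prod.mk_add_mk, Prod.mk.injEq, ← mul_add, mul_right_inj' hε, ← Nat.cast_add,
      Nat.cast_inj] using hK q hq
  have hdecomp : (fun z => ∑ n ∈ s, c n * sineWave P n (d n) z) =
      (2 * Complex.I)⁻¹ • (F 1 - F (-1)) := by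
    ext z
    simp only [F, sineWave_eq_sub, Pi.smul_apply, Pi.sub_apply, smul_eq_mul,
      ← Finset.sum_sub_distrib, Finset.mul_sum]
    exact Finset.sum_congr rfl fun n _ => by ring
  have hhalf : ‖(2 * Complex.I)⁻¹‖ₑ = 2⁻¹ := by
    rw [enorm_inv (by simp), enorm_mul, ← ofReal_norm, ← ofReal_norm]
    simp
  calc eLpNorm (fun z => ∑ n ∈ s, c n * sineWave P n (d n) z) 4 (cellMeasure P)
      = 2⁻¹ * eLpNorm (F 1 - F (-1)) 4 (cellMeasure P) := by
        rw [hdecomp, eLpNorm_const_smul, hhalf]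
    _ ≤ 2⁻¹ * (R + R) := by
        gcongr
        exact (eLpNorm_sub_le (hmeas 1) (hmeas (-1)) (by norm_num)).trans
          (add_le_add (hF 1 one_ne_zero) (hF (-1) (by norm_num)))
    _ = R := by
        rw [← two_mul, ← mul_assoc, ENNReal.inv_mul_cancel (by simp) (by simp), one_mul]

theorem eq_or_eq_swap_of_add_eq_of_sq_add_sq_eq {a b m n : ℤ} (h : m + n = a + b)
    (h2 : m ^ 2 + n ^ 2 = a ^ 2 + b ^ 2) : m = a ∧ n = b ∨ m = b ∧ n = a := by
  have hprod : (m - a) * (m - b) = 0 := by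
    obtain rfl : n = a + b - m := by linarith
    linarith
  rcases mul_eq_zero.1 hprod with hm | hm
  · exact .inl (by omega)
  · exact .inr (by omega)

/-- The `L⁴` Strichartz estimate for the periodic Schrödinger equation: a point of the parabola and
another one are determined by their sum. -/
theorem exists_eLpNorm_sum_schrodinger_le (P : ℝ) [Fact (0 < P)] {M : ℕ} (hM : 0 < M) :
    ∃ C : ℝ≥0, ∀ (s : Finset ℕ) (c : ℕ → ℂ),
      eLpNorm (fun z => ∑ n ∈ s, c n * sineWave P n (-(M * n ^ 2)) z) 4 (cellMeasure P) ≤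
        C * (∑ n ∈ s, ‖c n‖ₑ ^ 2) ^ (1 / 2 : ℝ) := by
  refine ⟨((cellMeasure P univ * 2) ^ (1 / 4 : ℝ)).toNNReal, fun s c => ?_⟩
  rw [ENNReal.coe_toNNReal (by finiteness)]
  have hK : ∀ q ∈ s ×ˢ s, ∑ p ∈ s ×ˢ s with p.1 + p.2 = q.1 + q.2 ∧
      -((M : ℤ) * p.1 ^ 2) + -(M * p.2 ^ 2) = -(M * q.1 ^ 2) + -(M * q.2 ^ 2),
      ((1 : ℝ≥0∞) * 1)⁻¹ ≤ 2 := fun q _ => by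
    simp only [mul_one, inv_one, Finset.sum_const, nsmul_eq_mul]
    norm_cast
    refine (Finset.card_le_card (t := {q, q.swap}) fun p hp => ?_).trans Finset.card_le_two
    obtain ⟨-, hsum, hsq⟩ := Finset.mem_filter.1 hp
    have hsq' : (p.1 : ℤ) ^ 2 + p.2 ^ 2 = q.1 ^ 2 + q.2 ^ 2 := by
      refine mul_left_cancel₀ (by positivity : (M : ℤ) ≠ 0) ?_
      push_cast at hsq
      linarith
    have := eq_or_eq_swap_of_add_eq_of_sq_add_sq_eq (by exact_mod_cast hsum) hsq'
    simpa [Prod.ext_iff] using this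
  simpa only [one_mul] using eLpNorm_sum_sineWave_le (P := P) (w := fun _ => 1)
    (fun _ => one_ne_zero) (fun _ => ENNReal.one_ne_top) hK c

theorem sum_inv_bracket_mul_bracket_le {A : Finset (ℕ × ℕ)} {m : ℕ} (hA : ∀ p ∈ A, p.1 + p.2 = m)
    (s : ℝ) : ∑ p ∈ A, (bracket p.1 ^ s * bracket p.2 ^ s)⁻¹ ≤ ∑' k, (bracket k ^ (s * 2))⁻¹ := by
  set S := ∑' k, (bracket k ^ (s * 2))⁻¹
  have hle : ∀ f : ℕ × ℕ → ℕ, InjOn f A → ∑ p ∈ A, (bracket (f p) ^ (s * 2))⁻¹ ≤ S := fun f hf => by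
    rw [← Finset.sum_image (f := fun n : ℕ => (bracket n ^ (s * 2))⁻¹) hf]
    exact (ENNReal.sum_le_tsum _).trans (tsum_natCast_le_tsum fun k => (bracket k ^ (s * 2))⁻¹)
  have hfst : InjOn Prod.fst (A : Set (ℕ × ℕ)) := fun p hp q hq h => by
    have := hA p hp
    have := hA q hq
    ext <;> omega
  have hsnd : InjOn Prod.snd (A : Set (ℕ × ℕ)) := fun p hp q hq h => by
    have := hA p hp
    have := hA q hq
    ext <;> omega
  have hterm : ∀ p : ℕ × ℕ, bracket p.1 ^ (s * 2) * ((bracket p.1 ^ s * bracket p.2 ^ s)⁻¹) ^ 2 =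
      (bracket p.2 ^ (s * 2))⁻¹ := fun p => by
    rw [ENNReal.rpow_mul, ENNReal.rpow_mul, ENNReal.rpow_ofNat, ENNReal.rpow_ofNat,
      ENNReal.mul_inv (.inl (bracket_rpow_ne_zero _ _)) (.inl (bracket_rpow_ne_top _ _)), mul_pow,
      ← mul_assoc, ← mul_pow,
      ENNReal.mul_inv_cancel (bracket_rpow_ne_zero _ _) (bracket_rpow_ne_top _ _), one_pow,
      one_mul, ENNReal.inv_pow]
  rw [← ENNReal.pow_le_pow_left_iff two_ne_zero]
  calc (∑ p ∈ A, (bracket p.1 ^ s * bracket p.2 ^ s)⁻¹) ^ 2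
      ≤ (∑ p ∈ A, (bracket p.1 ^ (s * 2))⁻¹) * ∑ p ∈ A, (bracket p.2 ^ (s * 2))⁻¹ := by
        simpa only [hterm] using sum_sq_le_sum_inv_mul_sum
          (w := fun p : ℕ × ℕ => bracket p.1 ^ (s * 2)) (fun p => bracket_rpow_ne_zero _ _)
          (fun p => bracket_rpow_ne_top _ _) A fun p => (bracket p.1 ^ s * bracket p.2 ^ s)⁻¹
    _ ≤ S ^ 2 := (mul_le_mul' (hle _ hfst) (hle _ hsnd)).trans_eq (sq S).symm

/-- The Sobolev embedding `H^{3/10} ⊆ L⁴` for sine series in one variable. -/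
theorem exists_eLpNorm_sum_sine_le (P : ℝ) [Fact (0 < P)] : ∃ C : ℝ≥0, ∀ (s : Finset ℕ)
    (c : ℕ → ℂ), eLpNorm (fun z => ∑ n ∈ s, c n * sineWave P n 0 z) 4 (cellMeasure P) ≤
      C * (∑ n ∈ s, bracket n ^ (3 / 5 : ℝ) * ‖c n‖ₑ ^ 2) ^ (1 / 2 : ℝ) := by
  set S := ∑' k : ℤ, (bracket k ^ ((3 / 5 : ℝ) * 2))⁻¹
  have hS : S ≠ ∞ := tsum_inv_bracket_rpow_ne_top (by norm_num)
  refine ⟨((cellMeasure P univ * S) ^ (1 / 4 : ℝ)).toNNReal, fun s c => ?_⟩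
  rw [ENNReal.coe_toNNReal (by finiteness)]
  exact eLpNorm_sum_sineWave_le (d := fun _ => 0) (fun n => bracket_rpow_ne_zero n _)
    (fun n => bracket_rpow_ne_top n _)
    (fun q _ => sum_inv_bracket_mul_bracket_le (fun p hp => (Finset.mem_filter.1 hp).2.1) _) c

end Torus

section Coefficients

/-- The squared `H^{1/2}` norm `∑ ⟨k⟩ |a_k|²` of the trigonometric series with coefficients `a`. -/
def halfEnergy (a : ℤ → ℂ) : ℝ≥0∞ := ∑' k, bracket k * ‖a k‖ₑ ^ 2

/-- The coefficient `P n a_k / (k + M n²)` with which the frequency `k` of the boundary datum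
enters the `n`-th mode. It is set to `0` at the resonance `k = -M n²`, which is accounted for
separately. -/
def duhamelCoeff (P : ℝ) (M : ℕ) (a : ℤ → ℂ) (n : ℕ) (k : ℤ) : ℂ :=
  if k + M * n ^ 2 = 0 then 0 else P * n * a k / ((k + M * n ^ 2 : ℤ) : ℂ)

/-- The part of `duhamelCoeff` with `M n² ≤ 2 |k|`, where `n` is controlled by `⟨k⟩^{1/2}`. -/
def nearCoeff (P : ℝ) (M : ℕ) (a : ℤ → ℂ) (n : ℕ) (k : ℤ) : ℂ :=
  if M * n ^ 2 ≤ 2 * k.natAbs then duhamelCoeff P M a n k else 0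

/-- The part of `duhamelCoeff` with `2 |k| < M n²`, where `⟨k + M n²⟩` is comparable to `⟨n⟩²`. -/
def farCoeff (P : ℝ) (M : ℕ) (a : ℤ → ℂ) (n : ℕ) (k : ℤ) : ℂ :=
  if M * n ^ 2 ≤ 2 * k.natAbs then 0 else duhamelCoeff P M a n k

variable {P : ℝ} {M : ℕ}

theorem nearCoeff_add_farCoeff (a : ℤ → ℂ) (n : ℕ) (k : ℤ) :
    nearCoeff P M a n k + farCoeff P M a n k = duhamelCoeff P M a n k := by
  unfold nearCoeff farCoeff
  split_ifs <;> simp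

theorem enorm_intCast_complex (l : ℤ) : ‖(l : ℂ)‖ₑ = l.natAbs := by
  rw [← ofReal_norm, Complex.norm_intCast, ← Int.cast_abs, ← Nat.cast_natAbs,
    ENNReal.ofReal_natCast]

theorem enorm_duhamelCoeff_le (a : ℤ → ℂ) (n : ℕ) (k : ℤ) :
    ‖duhamelCoeff P M a n k‖ₑ ≤ 2 * ‖P‖ₑ * n * ‖a k‖ₑ * (bracket (k + M * n ^ 2))⁻¹ := by
  unfold duhamelCoeff
  split_ifs with hres
  · simp
  set l : ℤ := k + M * n ^ 2
  have hbracket : (l.natAbs : ℝ≥0∞)⁻¹ ≤ 2 * (bracket l)⁻¹ := by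
    rw [← ENNReal.rpow_one (l.natAbs : ℝ≥0∞), ← ENNReal.rpow_one (bracket l)]
    convert inv_rpow_le_of_le_mul zero_le_one two_ne_zero ENNReal.ofNat_ne_top ?_ using 2
    · rw [ENNReal.rpow_one]
    · have : l.natAbs ≠ 0 := by simpa using hres
      unfold bracket
      exact_mod_cast (by lia : l.natAbs + 1 ≤ 2 * l.natAbs)
  have hP : ‖(P : ℂ)‖ₑ = ‖P‖ₑ := by rw [← ofReal_norm, Complex.norm_real, ofReal_norm]
  rw [div_eq_mul_inv, enorm_mul, enorm_mul, enorm_mul, enorm_inv (by exact_mod_cast hres), hP,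
    enorm_intCast_complex, ← Int.cast_natCast n, enorm_intCast_complex, Int.natAbs_natCast]
  calc ‖P‖ₑ * n * ‖a k‖ₑ * (l.natAbs : ℝ≥0∞)⁻¹ ≤ ‖P‖ₑ * n * ‖a k‖ₑ * (2 * (bracket l)⁻¹) := by
        gcongr
    _ = _ := by ring

theorem exists_enorm_nearCoeff_sq_le (P : ℝ) (hM : 0 < M) : ∃ C : ℝ≥0, ∀ (a : ℤ → ℂ) n k,
    ‖nearCoeff P M a n k‖ₑ ^ 2 ≤
      C * (bracket k * ‖a k‖ₑ ^ 2) * (bracket (k + M * n ^ 2) ^ 2)⁻¹ := by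
  refine ⟨(8 * ‖P‖ₑ ^ 2).toNNReal, fun a n k => ?_⟩
  rw [ENNReal.coe_toNNReal (by finiteness)]
  unfold nearCoeff
  split_ifs with hk
  · have hn : (n : ℝ≥0∞) ^ 2 ≤ 2 * bracket k := by
      have : n ^ 2 ≤ 2 * (k.natAbs + 1) := by nlinarith
      unfold bracket
      exact_mod_cast this
    calc ‖duhamelCoeff P M a n k‖ₑ ^ 2
        ≤ (2 * ‖P‖ₑ * n * ‖a k‖ₑ * (bracket (k + M * n ^ 2))⁻¹) ^ 2 := by
          gcongr
          exact enorm_duhamelCoeff_le a n k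
      _ = 4 * ‖P‖ₑ ^ 2 * n ^ 2 * ‖a k‖ₑ ^ 2 * (bracket (k + M * n ^ 2) ^ 2)⁻¹ := by
          rw [ENNReal.inv_pow]
          ring
      _ ≤ 4 * ‖P‖ₑ ^ 2 * (2 * bracket k) * ‖a k‖ₑ ^ 2 * (bracket (k + M * n ^ 2) ^ 2)⁻¹ := by
          gcongr
      _ = _ := by ring
  · simp

theorem bracket_natCast_sq_le (hM : 0 < M) {n : ℕ} {k : ℤ} (hk : 2 * k.natAbs < M * n ^ 2) :
    bracket n ^ 2 ≤ 8 * bracket (k + M * n ^ 2) := by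
  have hn : 0 < n := by
    rw [Nat.pos_iff_ne_zero]
    rintro rfl
    simp at hk
  have hl : M * n ^ 2 ≤ 2 * (k + M * n ^ 2 : ℤ).natAbs := by lia
  have : (n + 1) ^ 2 ≤ 8 * ((k + M * n ^ 2 : ℤ).natAbs + 1) := by nlinarith
  unfold bracket
  exact_mod_cast this

theorem natCast_mul_inv_bracket_le (hM : 0 < M) {n : ℕ} {k : ℤ} (hk : 2 * k.natAbs < M * n ^ 2) :
    (n : ℝ≥0∞) * (bracket (k + M * n ^ 2))⁻¹ ≤ 8 * (bracket n)⁻¹ := by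
  have hinv := inv_rpow_le_of_le_mul zero_le_one (by norm_num) (by norm_num)
    (bracket_natCast_sq_le hM hk)
  have hn : (n : ℝ≥0∞) ≤ bracket n := by
    unfold bracket
    exact_mod_cast Nat.le_succ n
  simp only [ENNReal.rpow_one] at hinv
  calc (n : ℝ≥0∞) * (bracket (k + M * n ^ 2))⁻¹ ≤ bracket n * (8 * (bracket n ^ 2)⁻¹) := by gcongr
    _ = 8 * (bracket n * (bracket n)⁻¹ * (bracket n)⁻¹) := by
      rw [ENNReal.inv_pow]
      ring
    _ = 8 * (bracket n)⁻¹ := by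
      rw [ENNReal.mul_inv_cancel (bracket_ne_zero n) (bracket_ne_top n), one_mul]

theorem bracket_le_mul_bracket_natCast_sq {n : ℕ} {k : ℤ} (hk : 2 * k.natAbs < M * n ^ 2) :
    bracket k ≤ M * bracket n ^ 2 := by
  have : k.natAbs + 1 ≤ M * (n + 1) ^ 2 :=
    calc k.natAbs + 1 ≤ M * n ^ 2 := by lia
      _ ≤ M * (n + 1) ^ 2 := by gcongr; exact n.le_succ
  unfold bracket
  exact_mod_cast this

theorem exists_enorm_farCoeff_le (P : ℝ) (hM : 0 < M) : ∃ C : ℝ≥0, ∀ (a : ℤ → ℂ) (n : ℕ) k,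
    ‖farCoeff P M a n k‖ₑ ≤
      C * (bracket n ^ (7 / 8 : ℝ))⁻¹ * ((bracket k ^ (1 / 16 : ℝ))⁻¹ * ‖a k‖ₑ) := by
  have hM₀ : (M : ℝ≥0∞) ≠ 0 := by exact_mod_cast hM.ne'
  refine ⟨(16 * ‖P‖ₑ * M ^ (1 / 16 : ℝ)).toNNReal, fun a n k => ?_⟩
  rw [ENNReal.coe_toNNReal (by finiteness)]
  unfold farCoeff
  split_ifs with hk
  · simp
  rw [not_le] at hk
  have hfreq : (bracket n ^ (1 / 8 : ℝ))⁻¹ ≤ M ^ (1 / 16 : ℝ) * (bracket k ^ (1 / 16 : ℝ))⁻¹ := by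
    convert inv_rpow_le_of_le_mul (by norm_num : (0 : ℝ) ≤ 1 / 16) hM₀ (by simp)
      (bracket_le_mul_bracket_natCast_sq hk) using 2
    rw [← ENNReal.rpow_natCast, ← ENNReal.rpow_mul]
    norm_num
  have hsplit : (bracket n)⁻¹ = (bracket n ^ (7 / 8 : ℝ))⁻¹ * (bracket n ^ (1 / 8 : ℝ))⁻¹ := by
    rw [← ENNReal.rpow_neg, ← ENNReal.rpow_neg, ← bracket_rpow_add, ← ENNReal.rpow_neg_one]
    norm_num
  calc ‖duhamelCoeff P M a n k‖ₑ
      ≤ 2 * ‖P‖ₑ * n * ‖a k‖ₑ * (bracket (k + M * n ^ 2))⁻¹ := enorm_duhamelCoeff_le a n k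
    _ = 2 * ‖P‖ₑ * ‖a k‖ₑ * (n * (bracket (k + M * n ^ 2))⁻¹) := by ring
    _ ≤ 2 * ‖P‖ₑ * ‖a k‖ₑ * (8 * ((bracket n ^ (7 / 8 : ℝ))⁻¹ *
          (M ^ (1 / 16 : ℝ) * (bracket k ^ (1 / 16 : ℝ))⁻¹))) := by
        refine mul_le_mul_right ((natCast_mul_inv_bracket_le hM hk).trans ?_) _
        rw [hsplit]
        gcongr
    _ = _ := by ring

end Coefficients

section CoefficientSums

variable {M : ℕ}

theorem exists_tsum_weight_nearCoeff_le (P : ℝ) (hM : 0 < M) : ∃ C : ℝ≥0, ∀ a : ℤ → ℂ,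
    ∑' (n : ℕ) (k : ℤ), bracket (k + M * n ^ 2) ^ (5 / 4 : ℝ) * ‖nearCoeff P M a n k‖ₑ ^ 2 ≤
      C * halfEnergy a := by
  obtain ⟨A, hA⟩ := exists_enorm_nearCoeff_sq_le P hM
  obtain ⟨C, hC⟩ := exists_tsum_inv_bracket_quadratic_le hM
  refine ⟨A * C, fun a => ?_⟩
  have hexp (l : ℤ) :
      bracket l ^ (5 / 4 : ℝ) * (bracket l ^ 2)⁻¹ = (bracket l ^ (3 / 4 : ℝ))⁻¹ := by
    rw [← ENNReal.rpow_natCast, ← ENNReal.rpow_neg, ← ENNReal.rpow_neg, ← bracket_rpow_add]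
    norm_num
  calc ∑' (n : ℕ) (k : ℤ), bracket (k + M * n ^ 2) ^ (5 / 4 : ℝ) * ‖nearCoeff P M a n k‖ₑ ^ 2
      ≤ ∑' (n : ℕ) (k : ℤ), A * (bracket k * ‖a k‖ₑ ^ 2) *
          (bracket (k + M * n ^ 2) ^ (3 / 4 : ℝ))⁻¹ := by
        refine ENNReal.tsum_le_tsum fun n => ENNReal.tsum_le_tsum fun k => ?_
        refine (mul_le_mul_right (hA a n k) _).trans_eq ?_
        rw [mul_left_comm, hexp]
    _ = ∑' k : ℤ, A * (bracket k * ‖a k‖ₑ ^ 2) *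
          ∑' n : ℕ, (bracket (k + M * n ^ 2) ^ (3 / 4 : ℝ))⁻¹ := by
        rw [ENNReal.tsum_comm]
        simp only [ENNReal.tsum_mul_left]
    _ ≤ ∑' k : ℤ, A * (bracket k * ‖a k‖ₑ ^ 2) * C := by
        gcongr with k
        exact hC k
    _ = (A * C : ℝ≥0) * halfEnergy a := by
        rw [ENNReal.tsum_mul_right, ENNReal.tsum_mul_left, halfEnergy, ENNReal.coe_mul]
        ring

theorem exists_tsum_inv_bracket_mul_le : ∃ C : ℝ≥0, ∀ a : ℤ → ℂ,
    ∑' k : ℤ, (bracket k ^ (1 / 16 : ℝ))⁻¹ * ‖a k‖ₑ ≤ C * halfEnergy a ^ (1 / 2 : ℝ) := by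
  set S := ∑' k : ℤ, (bracket k ^ (9 / 8 : ℝ))⁻¹
  have hS : S ≠ ∞ := tsum_inv_bracket_rpow_ne_top (by norm_num)
  refine ⟨(S ^ (1 / 2 : ℝ)).toNNReal, fun a => ?_⟩
  rw [ENNReal.coe_toNNReal (by finiteness), ← ENNReal.mul_rpow_of_nonneg _ _ (by norm_num)]
  refine le_rpow_half_of_sq_le ?_
  convert tsum_sq_le_tsum_inv_mul_tsum (fun k => bracket_rpow_ne_zero k (9 / 8))
    (fun k => bracket_rpow_ne_top k (9 / 8)) (fun k => (bracket k ^ (1 / 16 : ℝ))⁻¹ * ‖a k‖ₑ)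
    using 2
  refine tsum_congr fun k => ?_
  rw [mul_pow, ← mul_assoc, ← ENNReal.rpow_neg, ← ENNReal.rpow_natCast (bracket k ^ _),
    ← ENNReal.rpow_mul, ← bracket_rpow_add]
  norm_num

theorem exists_tsum_rpow_nearCoeff_le (P : ℝ) (hM : 0 < M) : ∃ C : ℝ≥0, ∀ a : ℤ → ℂ,
    ∑' l : ℤ, (∑' n : ℕ, ‖nearCoeff P M a n (l - M * n ^ 2)‖ₑ ^ 2) ^ (1 / 2 : ℝ) ≤
      C * halfEnergy a ^ (1 / 2 : ℝ) := by
  obtain ⟨C, hC⟩ := exists_tsum_weight_nearCoeff_le P hM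
  set S := ∑' k : ℤ, (bracket k ^ (5 / 4 : ℝ))⁻¹
  have hS : S ≠ ∞ := tsum_inv_bracket_rpow_ne_top (by norm_num)
  refine ⟨((S * C) ^ (1 / 2 : ℝ)).toNNReal, fun a => ?_⟩
  rw [ENNReal.coe_toNNReal (by finiteness), ← ENNReal.mul_rpow_of_nonneg _ _ (by norm_num)]
  refine le_rpow_half_of_sq_le ((tsum_sq_le_tsum_inv_mul_tsum
    (fun l => bracket_rpow_ne_zero l (5 / 4)) (fun l => bracket_rpow_ne_top l (5 / 4)) _).trans ?_)
  rw [mul_assoc]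
  gcongr
  refine le_of_eq_of_le ?_ (hC a)
  simp only [ennreal_rpow_half_sq, ← ENNReal.tsum_mul_left]
  rw [ENNReal.tsum_comm]
  refine tsum_congr fun n => ?_
  rw [← (Equiv.addRight ((M : ℤ) * (n : ℤ) ^ 2)).tsum_eq]
  simp only [Equiv.coe_addRight, add_sub_cancel_right]

theorem exists_tsum_tsum_nearCoeff_sq_le (P : ℝ) (hM : 0 < M) : ∃ C : ℝ≥0, ∀ a : ℤ → ℂ,
    ∑' n : ℕ, (∑' k : ℤ, ‖nearCoeff P M a n k‖ₑ) ^ 2 ≤ C * halfEnergy a := by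
  obtain ⟨C, hC⟩ := exists_tsum_weight_nearCoeff_le P hM
  set S := ∑' k : ℤ, (bracket k ^ (5 / 4 : ℝ))⁻¹
  have hS : S ≠ ∞ := tsum_inv_bracket_rpow_ne_top (by norm_num)
  refine ⟨(S * C).toNNReal, fun a => ?_⟩
  rw [ENNReal.coe_toNNReal (by finiteness)]
  calc ∑' n : ℕ, (∑' k : ℤ, ‖nearCoeff P M a n k‖ₑ) ^ 2
      ≤ ∑' n : ℕ, S * ∑' k : ℤ,
          bracket (k + M * n ^ 2) ^ (5 / 4 : ℝ) * ‖nearCoeff P M a n k‖ₑ ^ 2 := by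
        refine ENNReal.tsum_le_tsum fun n => ?_
        have hshift : ∑' k : ℤ, (bracket (k + M * n ^ 2) ^ (5 / 4 : ℝ))⁻¹ = S :=
          (Equiv.addRight ((M : ℤ) * (n : ℤ) ^ 2)).tsum_eq fun k => (bracket k ^ (5 / 4 : ℝ))⁻¹
        rw [← hshift]
        exact tsum_sq_le_tsum_inv_mul_tsum (fun k => bracket_rpow_ne_zero _ _)
          (fun k => bracket_rpow_ne_top _ _) _
    _ ≤ S * C * halfEnergy a := by
        rw [ENNReal.tsum_mul_left, mul_assoc]
        gcongr
        exact hC a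

theorem exists_tsum_tsum_farCoeff_sq_le (P : ℝ) (hM : 0 < M) : ∃ C : ℝ≥0, ∀ a : ℤ → ℂ,
    ∑' n : ℕ, (∑' k : ℤ, ‖farCoeff P M a n k‖ₑ) ^ 2 ≤ C * halfEnergy a := by
  obtain ⟨A, hA⟩ := exists_enorm_farCoeff_le P hM
  obtain ⟨C, hC⟩ := exists_tsum_inv_bracket_mul_le
  set S := ∑' k : ℤ, (bracket k ^ (7 / 4 : ℝ))⁻¹
  have hS : S ≠ ∞ := tsum_inv_bracket_rpow_ne_top (by norm_num)
  refine ⟨(A ^ 2 * C ^ 2 * S).toNNReal, fun a => ?_⟩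
  rw [ENNReal.coe_toNNReal (by finiteness)]
  have hterm (n : ℕ) : (∑' k : ℤ, ‖farCoeff P M a n k‖ₑ) ^ 2 ≤
      A ^ 2 * C ^ 2 * halfEnergy a * (bracket n ^ (7 / 4 : ℝ))⁻¹ := by
    calc (∑' k : ℤ, ‖farCoeff P M a n k‖ₑ) ^ 2
        ≤ (A * (bracket n ^ (7 / 8 : ℝ))⁻¹ * (C * halfEnergy a ^ (1 / 2 : ℝ))) ^ 2 := by
          gcongr
          refine (ENNReal.tsum_le_tsum fun k => hA a n k).trans ?_
          rw [ENNReal.tsum_mul_left]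
          gcongr
          exact hC a
      _ = A ^ 2 * C ^ 2 * halfEnergy a * (bracket n ^ (7 / 4 : ℝ))⁻¹ := by
          rw [mul_pow, mul_pow, mul_pow, ennreal_rpow_half_sq, ← ENNReal.inv_pow,
            ← ENNReal.rpow_natCast (bracket n ^ (7 / 8 : ℝ)), ← ENNReal.rpow_mul]
          norm_num
          ring
  calc ∑' n : ℕ, (∑' k : ℤ, ‖farCoeff P M a n k‖ₑ) ^ 2
      ≤ ∑' n : ℕ, A ^ 2 * C ^ 2 * halfEnergy a * (bracket n ^ (7 / 4 : ℝ))⁻¹ :=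
        ENNReal.tsum_le_tsum hterm
    _ ≤ A ^ 2 * C ^ 2 * halfEnergy a * S := by
        rw [ENNReal.tsum_mul_left]
        gcongr
        exact tsum_natCast_le_tsum fun k => (bracket k ^ (7 / 4 : ℝ))⁻¹
    _ = A ^ 2 * C ^ 2 * S * halfEnergy a := by ring

theorem exists_tsum_tsum_duhamelCoeff_sq_le (P : ℝ) (hM : 0 < M) : ∃ C : ℝ≥0, ∀ a : ℤ → ℂ,
    ∑' n : ℕ, (∑' k : ℤ, ‖duhamelCoeff P M a n k‖ₑ) ^ 2 ≤ C * halfEnergy a := by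
  obtain ⟨C₁, hC₁⟩ := exists_tsum_tsum_nearCoeff_sq_le P hM
  obtain ⟨C₂, hC₂⟩ := exists_tsum_tsum_farCoeff_sq_le P hM
  refine ⟨2 * (C₁ + C₂), fun a => ?_⟩
  calc ∑' n : ℕ, (∑' k : ℤ, ‖duhamelCoeff P M a n k‖ₑ) ^ 2
      ≤ ∑' n : ℕ, 2 * ((∑' k : ℤ, ‖nearCoeff P M a n k‖ₑ) ^ 2 +
          (∑' k : ℤ, ‖farCoeff P M a n k‖ₑ) ^ 2) := by
        refine ENNReal.tsum_le_tsum fun n => le_trans ?_ (ennreal_add_sq_le _ _)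
        rw [← ENNReal.tsum_add]
        gcongr with k
        rw [← nearCoeff_add_farCoeff]
        exact enorm_add_le _ _
    _ ≤ 2 * (C₁ * halfEnergy a + C₂ * halfEnergy a) := by
        rw [ENNReal.tsum_mul_left, ENNReal.tsum_add]
        gcongr
        exacts [hC₁ a, hC₂ a]
    _ = (2 * (C₁ + C₂) : ℝ≥0) * halfEnergy a := by
        push_cast
        ring

theorem exists_tsum_rpow_farCoeff_le (P : ℝ) (hM : 0 < M) : ∃ C : ℝ≥0, ∀ a : ℤ → ℂ,
    ∑' k : ℤ, (∑' n : ℕ, bracket n ^ (3 / 5 : ℝ) * ‖farCoeff P M a n k‖ₑ ^ 2) ^ (1 / 2 : ℝ) ≤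
      C * halfEnergy a ^ (1 / 2 : ℝ) := by
  obtain ⟨A, hA⟩ := exists_enorm_farCoeff_le P hM
  obtain ⟨C, hC⟩ := exists_tsum_inv_bracket_mul_le
  set S := ∑' k : ℤ, (bracket k ^ (23 / 20 : ℝ))⁻¹
  have hS : S ≠ ∞ := tsum_inv_bracket_rpow_ne_top (by norm_num)
  refine ⟨(S ^ (1 / 2 : ℝ) * A * C).toNNReal, fun a => ?_⟩
  rw [ENNReal.coe_toNNReal (by finiteness)]
  set b : ℤ → ℝ≥0∞ := fun k => (bracket k ^ (1 / 16 : ℝ))⁻¹ * ‖a k‖ₑ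
  have hexp (n : ℕ) : bracket n ^ (3 / 5 : ℝ) * ((bracket n ^ (7 / 8 : ℝ))⁻¹) ^ 2 =
      (bracket n ^ (23 / 20 : ℝ))⁻¹ := by
    rw [← ENNReal.rpow_natCast, ← ENNReal.rpow_neg, ← ENNReal.rpow_neg, ← ENNReal.rpow_mul,
      ← bracket_rpow_add]
    norm_num
  have hterm (k : ℤ) : ∑' n : ℕ, bracket n ^ (3 / 5 : ℝ) * ‖farCoeff P M a n k‖ₑ ^ 2 ≤
      S * (A * b k) ^ 2 := by
    calc ∑' n : ℕ, bracket n ^ (3 / 5 : ℝ) * ‖farCoeff P M a n k‖ₑ ^ 2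
        ≤ ∑' n : ℕ, bracket n ^ (3 / 5 : ℝ) * (A * (bracket n ^ (7 / 8 : ℝ))⁻¹ * b k) ^ 2 := by
          gcongr with n
          exact hA a n k
      _ = ∑' n : ℕ, (bracket n ^ (23 / 20 : ℝ))⁻¹ * (A * b k) ^ 2 := by
          simp only [← hexp]
          exact tsum_congr fun n => by ring
      _ ≤ S * (A * b k) ^ 2 := by
          rw [ENNReal.tsum_mul_right]
          gcongr
          exact tsum_natCast_le_tsum fun k => (bracket k ^ (23 / 20 : ℝ))⁻¹
  calc ∑' k : ℤ, (∑' n : ℕ, bracket n ^ (3 / 5 : ℝ) * ‖farCoeff P M a n k‖ₑ ^ 2) ^ (1 / 2 : ℝ)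
      ≤ ∑' k : ℤ, S ^ (1 / 2 : ℝ) * (A * b k) := by
        refine ENNReal.tsum_le_tsum fun k => ?_
        refine (ENNReal.rpow_le_rpow (hterm k) (by norm_num)).trans_eq ?_
        rw [ENNReal.mul_rpow_of_nonneg _ _ (by norm_num), ennreal_sq_rpow_half]
    _ ≤ S ^ (1 / 2 : ℝ) * (A * (C * halfEnergy a ^ (1 / 2 : ℝ))) := by
        rw [ENNReal.tsum_mul_left, ENNReal.tsum_mul_left]
        gcongr
        exact hC a
    _ = S ^ (1 / 2 : ℝ) * A * C * halfEnergy a ^ (1 / 2 : ℝ) := by ring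

theorem tsum_resonant_le (hM : 0 < M) (a : ℤ → ℂ) :
    ∑' n : ℕ, ‖(n : ℂ) * a (-(M * n ^ 2))‖ₑ ^ 2 ≤ halfEnergy a := by
  have hinj : Function.Injective fun n : ℕ => -((M : ℤ) * (n : ℤ) ^ 2) := fun n m h => by
    have hsq : (n : ℤ) ^ 2 = m ^ 2 := mul_left_cancel₀ (by positivity) (neg_injective h)
    exact_mod_cast (pow_left_inj₀ (by positivity) (by positivity) two_ne_zero).1 hsq
  refine le_trans (ENNReal.tsum_le_tsum fun n => ?_)
    (ENNReal.tsum_comp_le_tsum_of_injective hinj fun k => bracket k * ‖a k‖ₑ ^ 2)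
  have hbracket : (n : ℝ≥0∞) ^ 2 ≤ bracket (-(M * n ^ 2)) := by
    have : n ^ 2 ≤ (-((M : ℤ) * (n : ℤ) ^ 2)).natAbs + 1 := by
      rw [Int.natAbs_neg]
      exact (Nat.le_mul_of_pos_left _ hM).trans (Nat.le_succ _)
    unfold bracket
    exact_mod_cast this
  rw [enorm_mul, mul_pow, ← Int.cast_natCast n, enorm_intCast_complex, Int.natAbs_natCast]
  gcongr

end CoefficientSums

section Modes

theorem eLpNorm_le_tsum_of_hasSum {α ι : Type*} [Countable ι] {m : MeasurableSpace α}
    {μ : Measure α} {p : ℝ≥0∞} (hp : 1 ≤ p) {f : ι → α → ℂ} {F : α → ℂ}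
    (hf : ∀ i, AEStronglyMeasurable (f i) μ) (hF : ∀ x, HasSum (fun i => f i x) (F x)) :
    eLpNorm F p μ ≤ ∑' i, eLpNorm (f i) p μ := by
  obtain ⟨u, hu⟩ := Filter.exists_seq_tendsto (Filter.atTop : Filter (Finset ι))
  have hmeas (N : ℕ) : AEStronglyMeasurable (∑ i ∈ u N, f i) μ :=
    Finset.aestronglyMeasurable_sum _ fun i _ => hf i
  have hlim : ∀ᵐ x ∂μ, Filter.Tendsto (fun N => (∑ i ∈ u N, f i) x) Filter.atTop (nhds (F x)) := by
    simp only [Finset.sum_apply]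
    exact .of_forall fun x => (hF x).comp hu
  refine (Lp.eLpNorm_lim_le_liminf_eLpNorm hmeas F hlim).trans ?_
  refine Filter.liminf_le_of_frequently_le' (.of_forall fun N => ?_)
  exact (eLpNorm_sum_le (fun i _ => hf i) hp).trans (ENNReal.sum_le_tsum (u N))

variable {P : ℝ} {M : ℕ}

theorem summable_norm_mul_fourier {b : ℤ → ℂ} (hb : Summable fun k => ‖b k‖) (x : AddCircle P) :
    Summable fun k => ‖b k * fourier k x‖ := by
  simpa only [norm_mul, norm_fourier_apply, mul_one] using hb

theorem continuous_tsum_mul_fourier {b : ℤ → ℂ} (hb : Summable fun k => ‖b k‖) :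
    Continuous fun t : ℝ => ∑' k, b k * fourier k (t : AddCircle P) :=
  continuous_tsum (fun k => continuous_const.mul (continuous_fourier_coe k)) hb fun k t => by
    rw [norm_mul, norm_fourier_apply, mul_one]

/-- The shift by `d n` regroups the frequencies, so that each `l` carries a single superposition of
the waves `sineWave P n (d n)`. -/
theorem eLpNorm_sum_tsum_mul_fourier_le {b : ℕ → ℤ → ℂ} (hb : ∀ n, Summable fun k => ‖b n k‖)
    (s : Finset ℕ) (d : ℕ → ℤ) :
    eLpNorm (fun z : ℝ × ℝ => ∑ n ∈ s, (∑' k, b n k * fourier k (z.2 : AddCircle P)) *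
      Real.sin (n * Real.pi * z.1)) 4 (cellMeasure P) ≤
    ∑' l, eLpNorm (fun z => ∑ n ∈ s, b n (l + d n) * sineWave P n (d n) z) 4 (cellMeasure P) := by
  set f : ℤ → ℝ × ℝ → ℂ := fun l z => fourier l (z.2 : AddCircle P) *
    ∑ n ∈ s, b n (l + d n) * sineWave P n (d n) z
  have hf (l : ℤ) : Continuous (f l) :=
    ((continuous_fourier_coe l).comp continuous_snd).mul
      (continuous_finsetSum _ fun n _ => continuous_const.mul (continuous_sineWave n (d n)))
  have hnorm (l : ℤ) : eLpNorm (f l) 4 (cellMeasure P) =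
      eLpNorm (fun z => ∑ n ∈ s, b n (l + d n) * sineWave P n (d n) z) 4 (cellMeasure P) :=
    eLpNorm_congr_norm_ae (.of_forall fun z => by rw [norm_mul, norm_fourier_apply, one_mul])
  have hmode (n : ℕ) (z : ℝ × ℝ) : HasSum (fun l => fourier l (z.2 : AddCircle P) *
      (b n (l + d n) * sineWave P n (d n) z))
      ((∑' k, b n k * fourier k (z.2 : AddCircle P)) * Real.sin (n * Real.pi * z.1)) := by
    have h := (summable_norm_mul_fourier (hb n) (z.2 : AddCircle P)).of_norm.hasSum.mul_right
      (Real.sin (n * Real.pi * z.1) : ℂ)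
    rw [← (Equiv.addRight (d n)).hasSum_iff] at h
    refine (congrArg (HasSum · _) (funext fun l => ?_)).mpr h
    simp only [Function.comp_apply, Equiv.coe_addRight, fourier_add, sineWave]
    ring
  simp only [← hnorm]
  refine eLpNorm_le_tsum_of_hasSum (by norm_num) (fun l => (hf l).aestronglyMeasurable) fun z => ?_
  simp only [f, Finset.mul_sum]
  exact hasSum_sum fun n _ => hmode n z

theorem summable_duhamelCoeff (hM : 0 < M) {a : ℤ → ℂ} (ha : halfEnergy a ≠ ∞) (n : ℕ) :
    Summable fun k => ‖duhamelCoeff P M a n k‖ := by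
  obtain ⟨C, hC⟩ := exists_tsum_tsum_duhamelCoeff_sq_le P hM
  have hsq : (∑' k : ℤ, ‖duhamelCoeff P M a n k‖ₑ) ^ 2 ≠ ∞ :=
    ne_top_of_le_ne_top (by finiteness) ((ENNReal.le_tsum n).trans (hC a))
  exact summable_norm_iff.2 (Summable.of_enorm (mt (fun h => by simp [h]) hsq))

theorem summable_nearCoeff (hM : 0 < M) {a : ℤ → ℂ} (ha : halfEnergy a ≠ ∞) (n : ℕ) :
    Summable fun k => ‖nearCoeff P M a n k‖ := by
  refine (summable_duhamelCoeff (P := P) hM ha n).of_nonneg_of_le (fun _ => norm_nonneg _)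
    fun k => ?_
  unfold nearCoeff
  split_ifs
  · exact le_rfl
  · simpa only [norm_zero] using norm_nonneg _

theorem summable_farCoeff (hM : 0 < M) {a : ℤ → ℂ} (ha : halfEnergy a ≠ ∞) (n : ℕ) :
    Summable fun k => ‖farCoeff P M a n k‖ := by
  refine (summable_duhamelCoeff (P := P) hM ha n).of_nonneg_of_le (fun _ => norm_nonneg _)
    fun k => ?_
  unfold farCoeff
  split_ifs
  · simpa only [norm_zero] using norm_nonneg _
  · exact le_rfl

/-- The `n`-th sine coefficient of the boundary integral with datum `∑ a_k e^{2πi k t / P}`, for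
`P = 2 M / π`. The resonant frequency `k = -M n²` produces the term that grows linearly in `t`. -/
def modeCoeff (P : ℝ) (M : ℕ) (a : ℤ → ℂ) (n : ℕ) (t : ℝ) : ℂ :=
  t * (2 * Complex.I * Real.pi * (n * a (-(M * n ^ 2)))) *
      fourier (-(M * n ^ 2) : ℤ) (t : AddCircle P) +
    ∑' k : ℤ, duhamelCoeff P M a n k *
      (fourier k (t : AddCircle P) - fourier (-(M * n ^ 2) : ℤ) (t : AddCircle P))

theorem modeCoeff_eq (hM : 0 < M) {a : ℤ → ℂ} (ha : halfEnergy a ≠ ∞) (n : ℕ) (t : ℝ) :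
    modeCoeff P M a n t =
      (t * (2 * Complex.I * Real.pi * (n * a (-(M * n ^ 2)))) - ∑' k, duhamelCoeff P M a n k) *
          fourier (-(M * n ^ 2) : ℤ) (t : AddCircle P) +
        (∑' k, nearCoeff P M a n k * fourier k (t : AddCircle P) +
          ∑' k, farCoeff P M a n k * fourier k (t : AddCircle P)) := by
  have hD := summable_duhamelCoeff (P := P) hM ha n
  have hnear := summable_norm_mul_fourier (summable_nearCoeff (P := P) hM ha n) (t : AddCircle P)
  have hfar := summable_norm_mul_fourier (summable_farCoeff (P := P) hM ha n) (t : AddCircle P)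
  have hsplit : ∑' k, duhamelCoeff P M a n k * fourier k (t : AddCircle P) =
      ∑' k, nearCoeff P M a n k * fourier k (t : AddCircle P) +
        ∑' k, farCoeff P M a n k * fourier k (t : AddCircle P) := by
    rw [← hnear.of_norm.tsum_add hfar.of_norm]
    simp only [← add_mul, nearCoeff_add_farCoeff]
  rw [← hsplit, modeCoeff]
  simp only [mul_sub]
  rw [(summable_norm_mul_fourier hD _).of_norm.tsum_sub (hD.of_norm.mul_right _), tsum_mul_right]
  ring

theorem continuous_modeCoeff (hM : 0 < M) {a : ℤ → ℂ} (ha : halfEnergy a ≠ ∞) (n : ℕ) :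
    Continuous (modeCoeff P M a n) := by
  rw [funext (modeCoeff_eq hM ha n)]
  have hphase := continuous_fourier_coe (P := P) (-(M * n ^ 2))
  have hnear := continuous_tsum_mul_fourier (P := P) (summable_nearCoeff (P := P) hM ha n)
  have hfar := continuous_tsum_mul_fourier (P := P) (summable_farCoeff (P := P) hM ha n)
  fun_prop

theorem tsum_enorm_resonant_sq_le (hM : 0 < M) (a : ℤ → ℂ) :
    ∑' n : ℕ, ‖2 * Complex.I * Real.pi * (n * a (-(M * n ^ 2)))‖ₑ ^ 2 ≤
      ‖2 * Complex.I * (Real.pi : ℂ)‖ₑ ^ 2 * halfEnergy a := by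
  simp only [enorm_mul _ (_ * a _), mul_pow]
  rw [ENNReal.tsum_mul_left]
  gcongr
  exact tsum_resonant_le hM a

theorem exists_enorm_modeCoeff_le (P : ℝ) (hM : 0 < M) : ∃ C : ℝ≥0, ∀ a : ℤ → ℂ,
    ∃ γ : ℕ → ℝ≥0∞, (∀ n, ∀ t ∈ Icc 0 P, ‖modeCoeff P M a n t‖ₑ ≤ γ n) ∧
      ∑' n, γ n ^ 2 ≤ C * halfEnergy a := by
  obtain ⟨C, hC⟩ := exists_tsum_tsum_duhamelCoeff_sq_le P hM
  set A := ‖2 * Complex.I * (Real.pi : ℂ)‖ₑ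
  refine ⟨(2 * (‖P‖ₑ ^ 2 * A ^ 2 + 4 * C)).toNNReal, fun a =>
    ⟨fun n => ‖P‖ₑ * ‖2 * Complex.I * Real.pi * (n * a (-(M * n ^ 2)))‖ₑ +
      2 * ∑' k : ℤ, ‖duhamelCoeff P M a n k‖ₑ, fun n t ht => ?_, ?_⟩⟩
  · have hfourier (k : ℤ) : ‖fourier k (t : AddCircle P)‖ₑ = 1 := by
      rw [← ofReal_norm, norm_fourier_apply, ENNReal.ofReal_one]
    refine (enorm_add_le _ _).trans (add_le_add ?_ ?_)
    · rw [enorm_mul, hfourier, mul_one, enorm_mul]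
      gcongr
      rw [enorm_le_iff_norm_le, Complex.norm_real]
      exact abs_le_abs_of_nonneg ht.1 ht.2
    · refine enorm_tsum_le_tsum_enorm.trans ?_
      rw [← ENNReal.tsum_mul_left]
      refine ENNReal.tsum_le_tsum fun k => ?_
      rw [enorm_mul, mul_comm]
      gcongr
      refine enorm_sub_le.trans_eq ?_
      rw [hfourier, hfourier, one_add_one_eq_two]
  · rw [ENNReal.coe_toNNReal (by finiteness)]
    calc _ ≤ ∑' n : ℕ, 2 * (‖P‖ₑ ^ 2 * ‖2 * Complex.I * Real.pi * (n * a (-(M * n ^ 2)))‖ₑ ^ 2 +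
          4 * (∑' k : ℤ, ‖duhamelCoeff P M a n k‖ₑ) ^ 2) := by
          refine ENNReal.tsum_le_tsum fun n => (ennreal_add_sq_le _ _).trans_eq ?_
          rw [mul_pow, mul_pow]
          norm_num
      _ ≤ 2 * (‖P‖ₑ ^ 2 * (A ^ 2 * halfEnergy a) + 4 * (C * halfEnergy a)) := by
          rw [ENNReal.tsum_mul_left, ENNReal.tsum_add, ENNReal.tsum_mul_left, ENNReal.tsum_mul_left]
          gcongr
          exacts [tsum_enorm_resonant_sq_le hM a, hC a]
      _ = _ := by ring

theorem exists_eLpNorm_resonant_le (P : ℝ) [Fact (0 < P)] (hM : 0 < M) : ∃ C : ℝ≥0,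
    ∀ (a : ℤ → ℂ) (s : Finset ℕ), eLpNorm (fun z : ℝ × ℝ => ∑ n ∈ s,
      z.2 * (2 * Complex.I * Real.pi * (n * a (-(M * n ^ 2)))) * sineWave P n (-(M * n ^ 2)) z)
      4 (cellMeasure P) ≤ C * halfEnergy a ^ (1 / 2 : ℝ) := by
  obtain ⟨C, hC⟩ := exists_eLpNorm_sum_schrodinger_le P hM
  set A := ‖2 * Complex.I * (Real.pi : ℂ)‖ₑ
  refine ⟨P.toNNReal * C * A.toNNReal, fun a s => ?_⟩
  set c : ℕ → ℂ := fun n => 2 * Complex.I * Real.pi * (n * a (-(M * n ^ 2)))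
  set F : ℝ × ℝ → ℂ := fun z => ∑ n ∈ s, c n * sineWave P n (-(M * n ^ 2)) z
  have htime : ∀ᵐ z ∂cellMeasure P, ‖(z.2 : ℂ) * F z‖₊ ≤ P.toNNReal * ‖F z‖₊ := by
    rw [cellMeasure, Measure.prod_restrict]
    filter_upwards [ae_restrict_mem (measurableSet_Ioc.prod measurableSet_Ioc)] with z hz
    rw [nnnorm_mul]
    gcongr
    rw [← NNReal.coe_le_coe, coe_nnnorm, Complex.norm_real, Real.norm_of_nonneg hz.2.1.le]
    exact hz.2.2.trans (Real.le_coe_toNNReal P)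
  have hc : (∑ n ∈ s, ‖c n‖ₑ ^ 2) ^ (1 / 2 : ℝ) ≤ A * halfEnergy a ^ (1 / 2 : ℝ) := by
    rw [← ennreal_sq_rpow_half A, ← ENNReal.mul_rpow_of_nonneg _ _ (by norm_num)]
    gcongr
    exact (ENNReal.sum_le_tsum s).trans (tsum_enorm_resonant_sq_le hM a)
  have hA : A ≠ ∞ := enorm_ne_top
  have hfun : (fun z : ℝ × ℝ => ∑ n ∈ s, z.2 * c n * sineWave P n (-(M * n ^ 2)) z) =
      fun z => (z.2 : ℂ) * F z := by
    funext z
    simp only [F, Finset.mul_sum, mul_assoc]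
  simp only [c] at hfun
  rw [hfun]
  calc eLpNorm (fun z : ℝ × ℝ => (z.2 : ℂ) * F z) 4 (cellMeasure P)
      ≤ P.toNNReal * eLpNorm F 4 (cellMeasure P) :=
        eLpNorm_le_nnreal_smul_eLpNorm_of_ae_le_mul htime 4
    _ ≤ P.toNNReal * (C * (A * halfEnergy a ^ (1 / 2 : ℝ))) := by
        gcongr
        refine (hC s c).trans ?_
        gcongr
    _ = (P.toNNReal * C * A.toNNReal : ℝ≥0) * halfEnergy a ^ (1 / 2 : ℝ) := by
        push_cast
        rw [ENNReal.coe_toNNReal hA]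
        ring

theorem exists_eLpNorm_homogeneous_le (P : ℝ) [Fact (0 < P)] (hM : 0 < M) : ∃ C : ℝ≥0,
    ∀ (a : ℤ → ℂ) (s : Finset ℕ), eLpNorm (fun z : ℝ × ℝ => ∑ n ∈ s,
      (∑' k, duhamelCoeff P M a n k) * sineWave P n (-(M * n ^ 2)) z) 4 (cellMeasure P) ≤
      C * halfEnergy a ^ (1 / 2 : ℝ) := by
  obtain ⟨C₁, hC₁⟩ := exists_eLpNorm_sum_schrodinger_le P hM
  obtain ⟨C₂, hC₂⟩ := exists_tsum_tsum_duhamelCoeff_sq_le P hM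
  refine ⟨C₁ * C₂ ^ (1 / 2 : ℝ), fun a s => (hC₁ s _).trans ?_⟩
  rw [ENNReal.coe_mul, mul_assoc, ENNReal.coe_rpow_of_nonneg _ (by norm_num),
    ← ENNReal.mul_rpow_of_nonneg _ _ (by norm_num)]
  gcongr
  refine (ENNReal.sum_le_tsum s).trans ((ENNReal.tsum_le_tsum fun n => ?_).trans (hC₂ a))
  gcongr
  exact enorm_tsum_le_tsum_enorm

theorem exists_eLpNorm_near_le (P : ℝ) [Fact (0 < P)] (hM : 0 < M) : ∃ C : ℝ≥0, ∀ a : ℤ → ℂ,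
    halfEnergy a ≠ ∞ → ∀ s : Finset ℕ, eLpNorm (fun z : ℝ × ℝ => ∑ n ∈ s,
      (∑' k, nearCoeff P M a n k * fourier k (z.2 : AddCircle P)) * Real.sin (n * Real.pi * z.1))
      4 (cellMeasure P) ≤ C * halfEnergy a ^ (1 / 2 : ℝ) := by
  obtain ⟨C₁, hC₁⟩ := exists_eLpNorm_sum_schrodinger_le P hM
  obtain ⟨C₂, hC₂⟩ := exists_tsum_rpow_nearCoeff_le P hM
  refine ⟨C₁ * C₂, fun a ha s => ?_⟩
  refine (eLpNorm_sum_tsum_mul_fourier_le (summable_nearCoeff hM ha) s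
    fun n => -(M * n ^ 2)).trans ?_
  rw [ENNReal.coe_mul, mul_assoc]
  refine le_trans ?_ (mul_le_mul_right (hC₂ a) _)
  rw [← ENNReal.tsum_mul_left]
  refine ENNReal.tsum_le_tsum fun l => (hC₁ s _).trans ?_
  gcongr
  exact ENNReal.sum_le_tsum s

theorem exists_eLpNorm_far_le (P : ℝ) [Fact (0 < P)] (hM : 0 < M) : ∃ C : ℝ≥0, ∀ a : ℤ → ℂ,
    halfEnergy a ≠ ∞ → ∀ s : Finset ℕ, eLpNorm (fun z : ℝ × ℝ => ∑ n ∈ s,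
      (∑' k, farCoeff P M a n k * fourier k (z.2 : AddCircle P)) * Real.sin (n * Real.pi * z.1))
      4 (cellMeasure P) ≤ C * halfEnergy a ^ (1 / 2 : ℝ) := by
  obtain ⟨C₁, hC₁⟩ := exists_eLpNorm_sum_sine_le P
  obtain ⟨C₂, hC₂⟩ := exists_tsum_rpow_farCoeff_le P hM
  refine ⟨C₁ * C₂, fun a ha s => ?_⟩
  refine (eLpNorm_sum_tsum_mul_fourier_le (summable_farCoeff hM ha) s fun _ => 0).trans ?_
  rw [ENNReal.coe_mul, mul_assoc]
  refine le_trans ?_ (mul_le_mul_right (hC₂ a) _)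
  rw [← ENNReal.tsum_mul_left]
  simp only [add_zero]
  refine ENNReal.tsum_le_tsum fun k => (hC₁ s _).trans ?_
  gcongr
  exact ENNReal.sum_le_tsum s

theorem eLpNorm_sum_modeCoeff_le [Fact (0 < P)] (hM : 0 < M) {a : ℤ → ℂ} (ha : halfEnergy a ≠ ∞)
    (s : Finset ℕ) :
    eLpNorm (fun z : ℝ × ℝ => ∑ n ∈ s, modeCoeff P M a n z.2 * Real.sin (n * Real.pi * z.1)) 4
      (cellMeasure P) ≤
    (eLpNorm (fun z : ℝ × ℝ => ∑ n ∈ s,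
      z.2 * (2 * Complex.I * Real.pi * (n * a (-(M * n ^ 2)))) * sineWave P n (-(M * n ^ 2)) z)
      4 (cellMeasure P) +
    eLpNorm (fun z : ℝ × ℝ => ∑ n ∈ s,
      (∑' k, duhamelCoeff P M a n k) * sineWave P n (-(M * n ^ 2)) z)
      4 (cellMeasure P)) +
    (eLpNorm (fun z : ℝ × ℝ => ∑ n ∈ s,
      (∑' k, nearCoeff P M a n k * fourier k (z.2 : AddCircle P)) * Real.sin (n * Real.pi * z.1))
      4 (cellMeasure P) +
    eLpNorm (fun z : ℝ × ℝ => ∑ n ∈ s,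
      (∑' k, farCoeff P M a n k * fourier k (z.2 : AddCircle P)) * Real.sin (n * Real.pi * z.1))
      4 (cellMeasure P)) := by
  set F₁ : ℝ × ℝ → ℂ := fun z => ∑ n ∈ s,
    z.2 * (2 * Complex.I * Real.pi * (n * a (-(M * n ^ 2)))) * sineWave P n (-(M * n ^ 2)) z
  set F₂ : ℝ × ℝ → ℂ := fun z => ∑ n ∈ s,
    (∑' k, duhamelCoeff P M a n k) * sineWave P n (-(M * n ^ 2)) z
  set F₃ : ℝ × ℝ → ℂ := fun z => ∑ n ∈ s,
    (∑' k, nearCoeff P M a n k * fourier k (z.2 : AddCircle P)) * Real.sin (n * Real.pi * z.1)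
  set F₄ : ℝ × ℝ → ℂ := fun z => ∑ n ∈ s,
    (∑' k, farCoeff P M a n k * fourier k (z.2 : AddCircle P)) * Real.sin (n * Real.pi * z.1)
  have hdecomp : (fun z : ℝ × ℝ => ∑ n ∈ s, modeCoeff P M a n z.2 * Real.sin (n * Real.pi * z.1)) =
      (F₁ - F₂) + (F₃ + F₄) := by
    ext z
    simp only [F₁, F₂, F₃, F₄, Pi.add_apply, Pi.sub_apply, ← Finset.sum_add_distrib,
      ← Finset.sum_sub_distrib, modeCoeff_eq hM ha, sineWave]
    exact Finset.sum_congr rfl fun n _ => by ring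
  have hwave (n : ℕ) := continuous_sineWave (P := P) n (-(M * n ^ 2))
  have hF₁ : Continuous F₁ := by fun_prop
  have hF₂ : Continuous F₂ := by fun_prop
  have hF₃ : Continuous F₃ := continuous_finsetSum _ fun n _ =>
    ((continuous_tsum_mul_fourier (summable_nearCoeff hM ha n)).comp continuous_snd).mul
      (by fun_prop)
  have hF₄ : Continuous F₄ := continuous_finsetSum _ fun n _ =>
    ((continuous_tsum_mul_fourier (summable_farCoeff hM ha n)).comp continuous_snd).mul
      (by fun_prop)
  rw [hdecomp]
  refine (eLpNorm_add_le (hF₁.sub hF₂).aestronglyMeasurable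
    (hF₃.add hF₄).aestronglyMeasurable (by norm_num)).trans (add_le_add ?_ ?_)
  · exact eLpNorm_sub_le hF₁.aestronglyMeasurable hF₂.aestronglyMeasurable (by norm_num)
  · exact eLpNorm_add_le hF₃.aestronglyMeasurable hF₄.aestronglyMeasurable (by norm_num)

theorem exists_eLpNorm_sum_modeCoeff_le (P : ℝ) [Fact (0 < P)] (hM : 0 < M) : ∃ C : ℝ≥0,
    ∀ a : ℤ → ℂ, halfEnergy a ≠ ∞ → ∀ s : Finset ℕ,
      eLpNorm (fun z : ℝ × ℝ => ∑ n ∈ s, modeCoeff P M a n z.2 * Real.sin (n * Real.pi * z.1)) 4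
        (cellMeasure P) ≤ C * halfEnergy a ^ (1 / 2 : ℝ) := by
  obtain ⟨C₁, hC₁⟩ := exists_eLpNorm_resonant_le P hM
  obtain ⟨C₂, hC₂⟩ := exists_eLpNorm_homogeneous_le P hM
  obtain ⟨C₃, hC₃⟩ := exists_eLpNorm_near_le P hM
  obtain ⟨C₄, hC₄⟩ := exists_eLpNorm_far_le P hM
  refine ⟨C₁ + C₂ + (C₃ + C₄), fun a ha s => ?_⟩
  calc _ ≤ _ := eLpNorm_sum_modeCoeff_le hM ha s
    _ ≤ (C₁ * halfEnergy a ^ (1 / 2 : ℝ) + C₂ * halfEnergy a ^ (1 / 2 : ℝ)) +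
          (C₃ * halfEnergy a ^ (1 / 2 : ℝ) + C₄ * halfEnergy a ^ (1 / 2 : ℝ)) :=
        add_le_add (add_le_add (hC₁ a s) (hC₂ a s)) (add_le_add (hC₃ a ha s) (hC₄ a ha s))
    _ = (C₁ + C₂ + (C₃ + C₄) : ℝ≥0) * halfEnergy a ^ (1 / 2 : ℝ) := by
        push_cast
        ring

end Modes

section Circle

open AddCircle

theorem enorm_sq_eq_ofReal {E : Type*} [SeminormedAddCommGroup E] (x : E) :
    ‖x‖ₑ ^ 2 = ENNReal.ofReal (‖x‖ ^ 2) := by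
  rw [ENNReal.ofReal_pow (norm_nonneg _), ofReal_norm]

variable {P : ℝ}

theorem le_norm_fourier_sub_one (hP : 0 < P) {k : ℤ} {δ : ℝ} (h : 2 * |(k : ℝ)| * |δ| ≤ P) :
    4 * |(k : ℝ)| * |δ| / P ≤ ‖fourier k (δ : AddCircle P) - 1‖ := by
  set θ : ℝ := Real.pi * k * δ / P
  have hθ : |θ| = Real.pi * (|(k : ℝ)| * |δ| / P) := by
    rw [abs_div, abs_mul, abs_mul, abs_of_pos hP, abs_of_pos Real.pi_pos]
    ring
  have hθ' : |θ| ≤ Real.pi / 2 := by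
    rw [hθ, div_eq_mul_inv Real.pi]
    gcongr
    rw [div_le_iff₀ hP]
    linarith
  have hexp : fourier k (δ : AddCircle P) = Complex.exp (Complex.I * (2 * θ : ℝ)) := by
    rw [fourier_coe_apply]
    simp only [θ]
    push_cast
    ring_nf
  rw [hexp, Complex.norm_exp_I_mul_ofReal_sub_one, mul_div_cancel_left₀ _ two_ne_zero, norm_mul,
    Real.norm_ofNat, Real.norm_eq_abs]
  calc 4 * |(k : ℝ)| * |δ| / P = 2 * (2 / Real.pi * |θ|) := by
        rw [hθ]
        field_simp
        ring
    _ ≤ 2 * |Real.sin θ| := by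
        gcongr
        exact Real.mul_abs_le_abs_sin hθ'

variable [hP : Fact (0 < P)]

theorem tsum_enorm_fourierCoeff_sq {F : AddCircle P → ℂ} (hF : MemLp F 2 haarAddCircle) :
    ∑' k, ‖fourierCoeff F k‖ₑ ^ 2 = ∫⁻ y, ‖F y‖ₑ ^ 2 ∂haarAddCircle := by
  have h := hasSum_sq_fourierCoeff (hF.toLp F)
  have hint : ∫ y, ‖hF.toLp F y‖ ^ 2 ∂haarAddCircle = ∫ y, ‖F y‖ ^ 2 ∂haarAddCircle :=
    integral_congr_ae (hF.coeFn_toLp.mono fun y hy => by simp only [hy])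
  simp only [hint, fourierCoeff_congr_ae hF.coeFn_toLp] at h
  simp only [enorm_sq_eq_ofReal]
  rw [← ENNReal.ofReal_tsum_of_nonneg (fun _ => by positivity) h.summable, h.tsum_eq,
    ofReal_integral_eq_lintegral_ofReal ((memLp_two_iff_integrable_sq_norm hF.1).1 hF)
      (.of_forall fun _ => by positivity)]

theorem fourierCoeff_comp_add_right (F : AddCircle P → ℂ) (δ : AddCircle P) (k : ℤ) :
    fourierCoeff (fun y => F (y + δ)) k = fourier k δ * fourierCoeff F k := by
  have h := integral_add_right_eq_self (μ := (haarAddCircle : Measure (AddCircle P)))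
    (fun y => fourier (-k) (y - δ) • F y) δ
  simp only [add_sub_cancel_right] at h
  have hchar (y : AddCircle P) : fourier (-k) (y - δ) = fourier k δ * fourier (-k) y := by
    simp only [fourier_apply, ← Circle.coe_mul, ← toCircle_add]
    congr 2
    simp only [smul_sub, neg_smul]
    abel
  rw [fourierCoeff, h, fourierCoeff, ← integral_const_mul]
  simp only [hchar, smul_eq_mul, mul_assoc]

theorem tsum_enorm_fourier_sub_one_mul_sq {F : AddCircle P → ℂ} (hF : MemLp F 2 haarAddCircle)
    (δ : AddCircle P) : ∑' k, ‖fourier k δ - 1‖ₑ ^ 2 * ‖fourierCoeff F k‖ₑ ^ 2 =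
      ∫⁻ y, ‖F (y + δ) - F y‖ₑ ^ 2 ∂haarAddCircle := by
  have hFδ : MemLp (fun y => F (y + δ)) 2 haarAddCircle :=
    hF.comp_measurePreserving (measurePreserving_add_right haarAddCircle δ)
  refine Eq.trans (tsum_congr fun k => ?_) (tsum_enorm_fourierCoeff_sq (hFδ.sub hF))
  have hsub : fourierCoeff (fun y => F (y + δ) - F y) k =
      fourierCoeff (fun y => F (y + δ)) k - fourierCoeff F k := by
    simp only [fourierCoeff, smul_sub]
    exact integral_sub ((hFδ.integrable (by norm_num)).fourier_smul _)
      ((hF.integrable (by norm_num)).fourier_smul _)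
  rw [hsub, fourierCoeff_comp_add_right, ← mul_pow, ← enorm_mul, sub_mul, one_mul]

theorem tsum_lintegral_fourier_sub_one_mul_sq {F : AddCircle P → ℂ}
    (hF : MemLp F 2 haarAddCircle) :
    ∑' k, (∫⁻ δ : AddCircle P, ‖fourier k δ - 1‖ₑ ^ 2 / ‖δ‖ₑ ^ 2) * ‖fourierCoeff F k‖ₑ ^ 2 =
      ∫⁻ δ : AddCircle P, ∫⁻ y, ‖F (y + δ) - F y‖ₑ ^ 2 / ‖δ‖ₑ ^ 2 ∂haarAddCircle := by
  have hFδ (δ : AddCircle P) : AEMeasurable (fun y => ‖F (y + δ) - F y‖ₑ ^ 2) haarAddCircle :=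
    (((hF.1.comp_measurePreserving (measurePreserving_add_right haarAddCircle δ)).sub
      hF.1).enorm.pow_const 2)
  have hpull (k : ℤ) :
      (∫⁻ δ : AddCircle P, ‖fourier k δ - 1‖ₑ ^ 2 / ‖δ‖ₑ ^ 2) * ‖fourierCoeff F k‖ₑ ^ 2 =
      ∫⁻ δ : AddCircle P, ‖fourier k δ - 1‖ₑ ^ 2 * ‖fourierCoeff F k‖ₑ ^ 2 * (‖δ‖ₑ ^ 2)⁻¹ := by
    rw [← lintegral_mul_const' _ _ (by finiteness)]
    simp only [div_eq_mul_inv, mul_right_comm]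
  have hmeas (k : ℤ) : Measurable fun δ : AddCircle P =>
      ‖fourier k δ - 1‖ₑ ^ 2 * ‖fourierCoeff F k‖ₑ ^ 2 * (‖δ‖ₑ ^ 2)⁻¹ := by
    have := (fourier (T := P) k).continuous.measurable
    fun_prop
  simp only [hpull]
  rw [← lintegral_tsum fun k => (hmeas k).aemeasurable]
  refine lintegral_congr fun δ => ?_
  rw [ENNReal.tsum_mul_right, tsum_enorm_fourier_sub_one_mul_sq hF,
    ← lintegral_mul_const'' _ (hFδ δ)]
  simp only [div_eq_mul_inv]

theorem natAbs_le_mul_lintegral_fourier_sub_one (k : ℤ) : (k.natAbs : ℝ≥0∞) ≤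
    ENNReal.ofReal P * ∫⁻ δ : AddCircle P, ‖fourier k δ - 1‖ₑ ^ 2 / ‖δ‖ₑ ^ 2 := by
  have hP0 : 0 < P := hP.out
  rcases eq_or_ne k 0 with rfl | hk
  · simp
  have hk1 : (1 : ℝ) ≤ |(k : ℝ)| := mod_cast Int.one_le_abs hk
  set v := P / (2 * |(k : ℝ)|)
  have hvP : v ≤ P / 2 := div_le_div_of_nonneg_left hP0.le two_pos (by linarith)
  have hpoint : ∀ δ ∈ Ioo 0 v, ENNReal.ofReal ((4 * |(k : ℝ)| / P) ^ 2) ≤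
      ‖fourier k (δ : AddCircle P) - 1‖ₑ ^ 2 / ‖(δ : AddCircle P)‖ₑ ^ 2 := by
    intro δ hδ
    have hδP : |δ| ≤ |P| / 2 := by
      rw [abs_of_pos hP0, abs_of_pos hδ.1]
      exact hδ.2.le.trans hvP
    have hδk : 2 * |(k : ℝ)| * |δ| ≤ P := by
      rw [abs_of_pos hδ.1, ← le_div_iff₀' (by positivity)]
      exact hδ.2.le
    have hpos : 0 < |δ| := abs_pos.2 hδ.1.ne'
    rw [enorm_sq_eq_ofReal, enorm_sq_eq_ofReal, (norm_coe_eq_abs_iff P hP0.ne').2 hδP,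
      ← ENNReal.ofReal_div_of_pos (by positivity), ← div_pow]
    refine ENNReal.ofReal_le_ofReal (pow_le_pow_left₀ (by positivity) ?_ 2)
    rw [le_div_iff₀ hpos]
    exact (le_norm_fourier_sub_one hP0 hδk).trans_eq' (by ring)
  calc (k.natAbs : ℝ≥0∞) ≤ ENNReal.ofReal (8 * |(k : ℝ)|) := by
        rw [← ENNReal.ofReal_natCast, Nat.cast_natAbs, Int.cast_abs]
        exact ENNReal.ofReal_le_ofReal (by linarith)
    _ = ENNReal.ofReal P * ∫⁻ _ in Ioo 0 v, ENNReal.ofReal ((4 * |(k : ℝ)| / P) ^ 2) := by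
        rw [setLIntegral_const, Real.volume_Ioo, ← ENNReal.ofReal_mul (by positivity),
          ← ENNReal.ofReal_mul hP0.le]
        congr 1
        simp only [v]
        field_simp
        ring
    _ ≤ _ := by
        rw [← AddCircle.lintegral_preimage P (-(P / 2))]
        refine mul_le_mul_right ((setLIntegral_mono' measurableSet_Ioo hpoint).trans
          (lintegral_mono_set fun δ hδ => ?_)) _
        exact ⟨by linarith [hδ.1], by linarith [hδ.2]⟩

theorem halfEnergy_fourierCoeff_le {F : AddCircle P → ℂ} (hF : MemLp F 2 haarAddCircle) :
    halfEnergy (fourierCoeff F) ≤ (∫⁻ y, ‖F y‖ₑ ^ 2 ∂haarAddCircle) + ENNReal.ofReal P *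
      ∫⁻ δ : AddCircle P, ∫⁻ y, ‖F (y + δ) - F y‖ₑ ^ 2 / ‖δ‖ₑ ^ 2 ∂haarAddCircle := by
  rw [← tsum_enorm_fourierCoeff_sq hF, ← tsum_lintegral_fourier_sub_one_mul_sq hF,
    ← ENNReal.tsum_mul_left, ← ENNReal.tsum_add]
  refine ENNReal.tsum_le_tsum fun k => ?_
  rw [bracket, Nat.cast_add, Nat.cast_one, add_mul, one_mul, add_comm, ← mul_assoc]
  gcongr
  exact natAbs_le_mul_lintegral_fourier_sub_one k

theorem lintegral_haarAddCircle (f : AddCircle P → ℝ≥0∞) :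
    ∫⁻ y, f y ∂haarAddCircle = (ENNReal.ofReal P)⁻¹ * ∫⁻ y, f y := by
  rw [volume_eq_smul_haarAddCircle, lintegral_smul_measure, smul_eq_mul, ← mul_assoc,
    ENNReal.inv_mul_cancel (by simpa using hP.out) ENNReal.ofReal_ne_top, one_mul]

theorem hasSum_fourierCoeff_mul_integral {F G : AddCircle P → ℂ} (hF : MemLp F 2 haarAddCircle)
    (hG : MemLp G 2 haarAddCircle) :
    HasSum (fun k => fourierCoeff F k * ∫ y, G y * fourier k y ∂haarAddCircle)
      (∫ y, G y * F y ∂haarAddCircle) := by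
  have hinner {H : AddCircle P → ℂ} {H' : Lp ℂ 2 (haarAddCircle : Measure (AddCircle P))}
      (hH : H' =ᵐ[haarAddCircle] H) :
      inner ℂ (hG.star.toLp _) H' = ∫ y, G y * H y ∂haarAddCircle := by
    rw [L2.inner_def]
    refine integral_congr_ae ?_
    filter_upwards [hG.star.coeFn_toLp, hH] with y h₁ h₂
    rw [h₁, h₂, RCLike.inner_apply', Pi.star_apply, starRingEnd_apply, star_star]
  have h := fourierBasis.hasSum_inner_mul_inner (hG.star.toLp _) (hF.toLp F)
  rw [hinner hF.coeFn_toLp] at h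
  refine (congrArg (HasSum · _) (funext fun k => ?_)).mpr h
  rw [coe_fourierBasis, hinner (coeFn_fourierLp 2 k), ← coe_fourierBasis,
    ← HilbertBasis.repr_apply_apply, fourierBasis_repr, fourierCoeff_congr_ae hF.coeFn_toLp,
    mul_comm]

end Circle

section Tent

theorem setLIntegral_comp_affine_le (G : ℝ → ℝ≥0∞) {α : ℝ} (hα : α ≠ 0) (β : ℝ) {s t : Set ℝ}
    (hs : MeasurableSet s) (hst : MapsTo (fun x => α * x + β) s t) :
    ∫⁻ x in s, G (α * x + β) ≤ ENNReal.ofReal |α|⁻¹ * ∫⁻ x in t, G x := by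
  have hinj : InjOn (fun x => α * x + β) s := fun x _ y _ h =>
    mul_left_cancel₀ hα (add_right_cancel h)
  have hder : ∀ x ∈ s, HasDerivWithinAt (fun x => α * x + β) α s x := fun x _ => by
    simpa using (((hasDerivAt_id x).const_mul α).add_const β).hasDerivWithinAt
  have himage := lintegral_image_eq_lintegral_abs_deriv_mul hs hder hinj G
  rw [lintegral_const_mul' _ _ ENNReal.ofReal_ne_top] at himage
  calc ∫⁻ x in s, G (α * x + β)
      = ENNReal.ofReal |α|⁻¹ * ∫⁻ x in (fun x => α * x + β) '' s, G x := by
        rw [himage, ← mul_assoc, ← ENNReal.ofReal_mul (by positivity),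
          inv_mul_cancel₀ (abs_ne_zero.2 hα), ENNReal.ofReal_one, one_mul]
    _ ≤ ENNReal.ofReal |α|⁻¹ * ∫⁻ x in t, G x := by
        gcongr
        exact hst.image_subset

theorem setLIntegral_Ioo_le_add (f : ℝ → ℝ≥0∞) (a b c : ℝ) :
    ∫⁻ s in Ioo a c, f s ≤ (∫⁻ s in Ioo a b, f s) + ∫⁻ s in Ioo b c, f s := by
  have hsub : Ioo a c ⊆ Ioo a b ∪ Ico b c := fun x hx => by
    rcases lt_or_ge x b with h | h
    · exact .inl ⟨hx.1, h⟩
    · exact .inr ⟨h, hx.2⟩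
  refine (lintegral_mono_set hsub).trans ((lintegral_union_le _ _ _).trans_eq ?_)
  rw [Measure.restrict_congr_set (Ioo_ae_eq_Ico (μ := volume) (a := b) (b := c))]

theorem lintegral_comp_norm_addCircle_le {P : ℝ} [hP : Fact (0 < P)] (G : ℝ → ℝ≥0∞) :
    ∫⁻ y : AddCircle P, G ‖y‖ ≤ 2 * ∫⁻ s in Ioo 0 (P / 2), G s := by
  have hnorm {s : ℝ} (hs : s ∈ Ioo (-(P / 2)) (P / 2)) : ‖(s : AddCircle P)‖ = |s| := by
    rw [AddCircle.norm_coe_eq_abs_iff P hP.out.ne', abs_of_pos hP.out]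
    exact (abs_lt.2 hs).le
  have hmaps : MapsTo (fun s : ℝ => -1 * s + 0) (Ioo (-(P / 2)) 0) (Ioo 0 (P / 2)) :=
    fun s hs => mem_Ioo.2 ⟨by linarith [hs.2], by linarith [hs.1]⟩
  have hneg := setLIntegral_comp_affine_le G (by norm_num) 0 measurableSet_Ioo hmaps
  simp only [neg_mul, one_mul, add_zero, abs_neg, abs_one, inv_one, ENNReal.ofReal_one] at hneg
  have hend : -(P / 2) + P = P / 2 := by ring
  rw [← AddCircle.lintegral_preimage P (-(P / 2)), hend,
    ← Measure.restrict_congr_set (Ioo_ae_eq_Ioc (μ := volume)),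
    setLIntegral_congr_fun measurableSet_Ioo fun s hs => congrArg G (hnorm hs), two_mul]
  refine (setLIntegral_Ioo_le_add _ _ 0 _).trans (add_le_add (hneg.trans_eq' ?_) (le_of_eq ?_))
  · exact setLIntegral_congr_fun measurableSet_Ioo fun s hs => by rw [abs_of_neg hs.2]
  · exact setLIntegral_congr_fun measurableSet_Ioo fun s hs => by rw [abs_of_pos hs.1]

/-- The even `P`-periodic function which is the identity on `[0,T]` and decreases linearly from `T`
to `0` on `[T,P/2]`. Composition with it extends functions on `(0,T)` to the circle without
creating jumps, so that it preserves `H^{1/2}`. -/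
def tent (T P : ℝ) (y : AddCircle P) : ℝ := min ‖y‖ (T / (P / 2 - T) * (P / 2 - ‖y‖))

variable {T P : ℝ}

theorem continuous_tent : Continuous (tent T P) := by
  unfold tent
  fun_prop

theorem tent_profile_of_le (hT : 0 < T) (hTP : 4 * T ≤ P) {s : ℝ} (hs : s ≤ T) :
    min s (T / (P / 2 - T) * (P / 2 - s)) = s := by
  have hpos : 0 < P / 2 - T := by linarith
  rw [min_eq_left_iff, div_mul_eq_mul_div, le_div_iff₀ hpos]
  nlinarith

theorem tent_profile_of_ge (hT : 0 < T) (hTP : 4 * T ≤ P) {s : ℝ} (hs : T ≤ s) :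
    min s (T / (P / 2 - T) * (P / 2 - s)) = T / (P / 2 - T) * (P / 2 - s) := by
  have hpos : 0 < P / 2 - T := by linarith
  rw [min_eq_right_iff, div_mul_eq_mul_div, div_le_iff₀ hpos]
  nlinarith

theorem tent_coe (hT : 0 < T) (hTP : 4 * T ≤ P) {s : ℝ} (hs : s ∈ Icc 0 T) :
    tent T P (s : AddCircle P) = s := by
  have hP : 0 < P := by linarith
  have hnorm : ‖(s : AddCircle P)‖ = s := by
    rw [(AddCircle.norm_coe_eq_abs_iff P hP.ne').2, abs_of_nonneg hs.1]
    rw [abs_of_nonneg hs.1, abs_of_pos hP]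
    linarith [hs.2]
  rw [tent, hnorm, tent_profile_of_le hT hTP hs.2]

theorem abs_tent_sub_le (hT : 0 < T) (hTP : 4 * T ≤ P) (y z : AddCircle P) :
    |tent T P y - tent T P z| ≤ ‖y - z‖ := by
  have hpos : 0 < P / 2 - T := by linarith
  have hslope : T / (P / 2 - T) ≤ 1 := (div_le_one hpos).2 (by linarith)
  have hnorm : |‖y‖ - ‖z‖| ≤ ‖y - z‖ := abs_norm_sub_norm_le y z
  refine (abs_min_sub_min_le_max _ _ _ _).trans (max_le hnorm ?_)
  rw [← mul_sub, sub_sub_sub_cancel_left, abs_mul, abs_of_pos (div_pos hT hpos), abs_sub_comm]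
  exact (mul_le_of_le_one_left (abs_nonneg _) hslope).trans hnorm

theorem lintegral_comp_tent_le [Fact (0 < P)] (hT : 0 < T) (hTP : 4 * T ≤ P) (G : ℝ → ℝ≥0∞) :
    ∫⁻ y : AddCircle P, G (tent T P y) ≤ ENNReal.ofReal (P / T) * ∫⁻ s in Ioo 0 T, G s := by
  have hpos : 0 < P / 2 - T := by linarith
  set c := T / (P / 2 - T) with hc
  have hc0 : 0 < c := div_pos hT hpos
  have hcT : c * (P / 2 - T) = T := div_mul_cancel₀ _ hpos.ne'
  have hrise : ∫⁻ s in Ioo 0 T, G (min s (c * (P / 2 - s))) = ∫⁻ s in Ioo 0 T, G s :=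
    setLIntegral_congr_fun measurableSet_Ioo fun s hs => by
      rw [tent_profile_of_le hT hTP hs.2.le]
  have hfall : ∫⁻ s in Ioo T (P / 2), G (min s (c * (P / 2 - s))) ≤
      ENNReal.ofReal c⁻¹ * ∫⁻ s in Ioo 0 T, G s := by
    rw [setLIntegral_congr_fun measurableSet_Ioo fun s hs => congrArg G
      ((tent_profile_of_ge hT hTP hs.1.le).trans
        (by ring : c * (P / 2 - s) = -c * s + c * (P / 2)))]
    have hmaps : MapsTo (fun s : ℝ => -c * s + c * (P / 2)) (Ioo T (P / 2)) (Ioo 0 T) :=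
      fun s hs => mem_Ioo.2 ⟨by nlinarith [hs.2], by nlinarith [hs.1]⟩
    have h := setLIntegral_comp_affine_le G (neg_ne_zero.2 hc0.ne') (c * (P / 2))
      measurableSet_Ioo hmaps
    rwa [abs_neg, abs_of_pos hc0] at h
  calc ∫⁻ y : AddCircle P, G (tent T P y)
      ≤ 2 * ∫⁻ s in Ioo 0 (P / 2), G (min s (c * (P / 2 - s))) :=
        lintegral_comp_norm_addCircle_le fun s => G (min s (c * (P / 2 - s)))
    _ ≤ 2 * ((∫⁻ s in Ioo 0 T, G s) + ENNReal.ofReal c⁻¹ * ∫⁻ s in Ioo 0 T, G s) := by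
        gcongr
        exact (setLIntegral_Ioo_le_add _ 0 T _).trans (add_le_add hrise.le hfall)
    _ = ENNReal.ofReal (2 * (1 + c⁻¹)) * ∫⁻ s in Ioo 0 T, G s := by
        rw [ENNReal.ofReal_mul two_pos.le, ENNReal.ofReal_add one_pos.le (by positivity),
          ENNReal.ofReal_one, ENNReal.ofReal_ofNat]
        ring
    _ = ENNReal.ofReal (P / T) * ∫⁻ s in Ioo 0 T, G s := by
        rw [hc]
        congr 2
        field_simp
        ring

theorem lintegral_comp_tent_gagliardo_le [Fact (0 < P)] (hT : 0 < T) (hTP : 4 * T ≤ P)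
    {h : ℝ → ℂ} (hm : Measurable h) :
    ∫⁻ δ : AddCircle P, ∫⁻ y : AddCircle P,
      ‖h (tent T P (y + δ)) - h (tent T P y)‖ₑ ^ 2 / ‖δ‖ₑ ^ 2 ≤
    ENNReal.ofReal (P / T) ^ 2 *
      ∫⁻ t in Ioo 0 T, ∫⁻ s in Ioo 0 T, ‖h t - h s‖ₑ ^ 2 / ‖t - s‖ₑ ^ 2 := by
  set g : ℝ → ℝ → ℝ≥0∞ := fun t s => ‖h t - h s‖ₑ ^ 2 / ‖t - s‖ₑ ^ 2
  have hcontract (y δ : AddCircle P) :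
      ‖h (tent T P (y + δ)) - h (tent T P y)‖ₑ ^ 2 / ‖δ‖ₑ ^ 2 ≤
        g (tent T P y) (tent T P (y + δ)) := by
    simp only [g]
    rw [enorm_sub_rev (h (tent T P (y + δ)))]
    refine ENNReal.div_le_div_left (pow_le_pow_left' (enorm_le_iff_norm_le.2 ?_) 2) _
    refine (abs_tent_sub_le hT hTP y (y + δ)).trans_eq ?_
    rw [sub_add_cancel_left, norm_neg]
  have hmeas : Measurable fun p : AddCircle P × AddCircle P =>
      ‖h (tent T P (p.2 + p.1)) - h (tent T P p.2)‖ₑ ^ 2 / ‖p.1‖ₑ ^ 2 := by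
    have := (continuous_tent (T := T) (P := P)).measurable
    fun_prop
  rw [lintegral_lintegral_swap hmeas.aemeasurable]
  calc _ ≤ ∫⁻ y : AddCircle P, ∫⁻ δ : AddCircle P, g (tent T P y) (tent T P (y + δ)) :=
        lintegral_mono fun y => lintegral_mono fun δ => hcontract y δ
    _ = ∫⁻ y : AddCircle P, ∫⁻ z : AddCircle P, g (tent T P y) (tent T P z) :=
        lintegral_congr fun y =>
          lintegral_add_left_eq_self (fun z => g (tent T P y) (tent T P z)) y
    _ ≤ ∫⁻ y : AddCircle P, ENNReal.ofReal (P / T) * ∫⁻ s in Ioo 0 T, g (tent T P y) s :=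
        lintegral_mono fun y => lintegral_comp_tent_le hT hTP (g (tent T P y))
    _ ≤ ENNReal.ofReal (P / T) * (ENNReal.ofReal (P / T) *
          ∫⁻ t in Ioo 0 T, ∫⁻ s in Ioo 0 T, g t s) := by
        rw [lintegral_const_mul' _ _ ENNReal.ofReal_ne_top]
        gcongr
        exact lintegral_comp_tent_le hT hTP fun t => ∫⁻ s in Ioo 0 T, g t s
    _ = _ := by ring

theorem eSobolevHalfNorm_sq (T : ℝ) (h : ℝ → ℂ) : eSobolevHalfNorm T h ^ 2 =
    (∫⁻ t in Ioo 0 T, ‖h t‖ₑ ^ 2) +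
      ∫⁻ t in Ioo 0 T, ∫⁻ s in Ioo 0 T, ‖h t - h s‖ₑ ^ 2 / ‖t - s‖ₑ ^ 2 := by
  rw [eSobolevHalfNorm, ennreal_rpow_half_sq]

theorem memLp_comp_tent [Fact (0 < P)] (hT : 0 < T) (hTP : 4 * T ≤ P) {h : ℝ → ℂ}
    (hm : Measurable h) (hh : eSobolevHalfNorm T h ≠ ∞) :
    MemLp (h ∘ tent T P) 2 AddCircle.haarAddCircle := by
  have hsq : eSobolevHalfNorm T h ^ 2 ≠ ∞ := by finiteness
  rw [eSobolevHalfNorm_sq] at hsq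
  refine MemLp.haarAddCircle ⟨(hm.comp continuous_tent.measurable).aestronglyMeasurable, ?_⟩
  rw [eLpNorm_lt_top_iff_lintegral_rpow_enorm_lt_top (by norm_num) (by norm_num)]
  simp only [ENNReal.toReal_ofNat, ENNReal.rpow_ofNat]
  exact (lintegral_comp_tent_le hT hTP fun s => ‖h s‖ₑ ^ 2).trans_lt
    (ENNReal.mul_lt_top ENNReal.ofReal_lt_top (ENNReal.add_ne_top.1 hsq).1.lt_top)

theorem exists_halfEnergy_comp_tent_le [hP : Fact (0 < P)] (hT : 0 < T) (hTP : 4 * T ≤ P) :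
    ∃ C : ℝ≥0, ∀ h : ℝ → ℂ, Measurable h → eSobolevHalfNorm T h ≠ ∞ →
      halfEnergy (fourierCoeff (h ∘ tent T P)) ≤ C * eSobolevHalfNorm T h ^ 2 := by
  have hP0 : ENNReal.ofReal P ≠ 0 := by simpa using hP.out
  set K := ENNReal.ofReal (P / T)
  have hK : K ≠ ∞ := ENNReal.ofReal_ne_top
  refine ⟨((ENNReal.ofReal P)⁻¹ * K + K ^ 2).toNNReal, fun h hm hh => ?_⟩
  rw [ENNReal.coe_toNNReal (by finiteness), eSobolevHalfNorm_sq]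
  set A := ∫⁻ t in Ioo 0 T, ‖h t‖ₑ ^ 2
  set G := ∫⁻ t in Ioo 0 T, ∫⁻ s in Ioo 0 T, ‖h t - h s‖ₑ ^ 2 / ‖t - s‖ₑ ^ 2
  have hmass : ∫⁻ y, ‖h (tent T P y)‖ₑ ^ 2 ∂AddCircle.haarAddCircle ≤
      (ENNReal.ofReal P)⁻¹ * (K * A) := by
    rw [lintegral_haarAddCircle]
    gcongr
    exact lintegral_comp_tent_le hT hTP fun s => ‖h s‖ₑ ^ 2
  have hseminorm : ∫⁻ δ : AddCircle P, ∫⁻ y, ‖h (tent T P (y + δ)) - h (tent T P y)‖ₑ ^ 2 /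
      ‖δ‖ₑ ^ 2 ∂AddCircle.haarAddCircle ≤ (ENNReal.ofReal P)⁻¹ * (K ^ 2 * G) := by
    simp only [lintegral_haarAddCircle]
    rw [lintegral_const_mul' _ _ (by finiteness)]
    gcongr
    exact lintegral_comp_tent_gagliardo_le hT hTP hm
  calc halfEnergy (fourierCoeff (h ∘ tent T P))
      ≤ (ENNReal.ofReal P)⁻¹ * (K * A) +
          ENNReal.ofReal P * ((ENNReal.ofReal P)⁻¹ * (K ^ 2 * G)) := by
        refine (halfEnergy_fourierCoeff_le (memLp_comp_tent hT hTP hm hh)).trans ?_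
        gcongr
        exacts [hmass, hseminorm]
    _ = (ENNReal.ofReal P)⁻¹ * K * A + K ^ 2 * G := by
        rw [ENNReal.mul_inv_cancel_left hP0 ENNReal.ofReal_ne_top, mul_assoc]
    _ ≤ ((ENNReal.ofReal P)⁻¹ * K + K ^ 2) * (A + G) := by
        rw [mul_add]
        gcongr
        exacts [le_self_add, le_add_self]

end Tent

section Expansion

open AddCircle

variable {P : ℝ} [hP : Fact (0 < P)]

theorem integral_fourier_of_ne_zero {k : ℤ} (hk : k ≠ 0) (t : ℝ) :
    ∫ τ in (0 : ℝ)..t, fourier k (τ : AddCircle P) =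
      P / (2 * Complex.I * Real.pi * k) * (fourier k (t : AddCircle P) - 1) := by
  have hP' : (P : ℂ) ≠ 0 := Complex.ofReal_ne_zero.2 hP.out.ne'
  have hk' : (k : ℂ) ≠ 0 := Int.cast_ne_zero.2 hk
  have hexp (τ : ℝ) : fourier k (τ : AddCircle P) =
      Complex.exp (2 * Real.pi * Complex.I * k / P * τ) := by
    rw [fourier_coe_apply]
    ring_nf
  simp only [hexp]
  rw [integral_exp_mul_complex (by simp [hP', hk'])]
  simp only [Complex.ofReal_zero, mul_zero, Complex.exp_zero]
  field_simp

theorem memLp_liftIoc_indicator_fourier (t : ℝ) (m : ℤ) :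
    MemLp (liftIoc P 0 ((Ioc 0 t).indicator fun τ : ℝ => fourier m (τ : AddCircle P))) 2
      haarAddCircle := by
  have hbound : MemLp ((Ioc 0 t).indicator fun τ : ℝ => fourier m (τ : AddCircle P)) 2
      (volume.restrict (Ioc 0 (0 + P))) := by
    refine MemLp.of_bound ((continuous_fourier_coe m).aestronglyMeasurable.indicator
      measurableSet_Ioc) 1 (.of_forall fun τ => ?_)
    exact (norm_indicator_le_norm_self _ _).trans (norm_fourier_apply m _).le
  exact hbound.memLp_liftIoc.haarAddCircle

theorem integral_liftIoc_indicator_fourier_mul (F : AddCircle P → ℂ) {t : ℝ} (ht : t ∈ Icc 0 P)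
    (m : ℤ) :
    ∫ y, liftIoc P 0 ((Ioc 0 t).indicator fun τ : ℝ => fourier m (τ : AddCircle P)) y * F y
        ∂haarAddCircle =
      (P : ℂ)⁻¹ * ∫ τ in (0 : ℝ)..t, fourier m (τ : AddCircle P) * F τ := by
  have hlift : ∀ τ ∈ Ioc 0 P,
      liftIoc P 0 ((Ioc 0 t).indicator fun τ : ℝ => fourier m (τ : AddCircle P)) τ * F τ =
        (Ioc 0 t).indicator (fun τ : ℝ => fourier m (τ : AddCircle P) * F τ) τ := fun τ hτ => by
    rw [liftIoc_coe_apply (by simpa using hτ)]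
    exact (indicator_mul_left _ _ fun τ : ℝ => F τ).symm
  rw [integral_haarAddCircle, ← AddCircle.integral_preimage P 0, Complex.real_smul,
    Complex.ofReal_inv, zero_add, setIntegral_congr_fun measurableSet_Ioc hlift,
    setIntegral_indicator measurableSet_Ioc,
    inter_eq_self_of_subset_right (Ioc_subset_Ioc_right ht.2),
    intervalIntegral.integral_of_le ht.1]

theorem hasSum_fourierCoeff_mul_integral_fourier {F : AddCircle P → ℂ}
    (hF : MemLp F 2 haarAddCircle) {t : ℝ} (ht : t ∈ Icc 0 P) (m : ℤ) :
    HasSum (fun k => fourierCoeff F k * ∫ τ in (0 : ℝ)..t, fourier (k + m) (τ : AddCircle P))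
      (∫ τ in (0 : ℝ)..t, fourier m (τ : AddCircle P) * F τ) := by
  have hP' : (P : ℂ) ≠ 0 := Complex.ofReal_ne_zero.2 hP.out.ne'
  have h := (hasSum_fourierCoeff_mul_integral hF
    (memLp_liftIoc_indicator_fourier t m)).mul_left (P : ℂ)
  simp only [integral_liftIoc_indicator_fourier_mul _ ht, mul_left_comm (fourierCoeff F _),
    mul_inv_cancel_left₀ hP', ← fourier_add, add_comm m] at h
  exact h

variable {M : ℕ}

theorem boundaryCoeff_eq_fourier (hPM : P = 2 * M / Real.pi) (h : ℝ → ℂ) (n : ℕ) (t : ℝ) :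
    boundaryCoeff h n t =
      2 * Complex.I * n * Real.pi * fourier (-(M * n ^ 2) : ℤ) (t : AddCircle P) *
        ∫ τ in (0 : ℝ)..t, fourier (M * n ^ 2 : ℤ) (τ : AddCircle P) * h τ := by
  have hM : (M : ℂ) ≠ 0 := by
    rintro hM
    have := hP.out
    simp_all
  have hfreq (τ : ℝ) : Complex.exp (Complex.I * ((n * Real.pi : ℝ) : ℂ) ^ 2 * τ) =
      fourier (M * n ^ 2 : ℤ) (τ : AddCircle P) := by
    rw [fourier_coe_apply, hPM]
    congr 1
    push_cast
    field_simp
  have hfreq_neg : Complex.exp (-Complex.I * ((n * Real.pi : ℝ) : ℂ) ^ 2 * t) =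
      fourier (-(M * n ^ 2) : ℤ) (t : AddCircle P) := by
    rw [fourier_coe_apply, hPM]
    congr 1
    push_cast
    field_simp
  simp only [boundaryCoeff, hfreq, hfreq_neg]

theorem duhamel_term_eq (a : ℤ → ℂ) (n : ℕ) (t : ℝ) (k : ℤ) :
    2 * Complex.I * n * Real.pi * fourier (-(M * n ^ 2) : ℤ) (t : AddCircle P) *
        (a k * ∫ τ in (0 : ℝ)..t, fourier (k + M * n ^ 2) (τ : AddCircle P)) =
      (if k = -(M * n ^ 2) then t * (2 * Complex.I * Real.pi * (n * a (-(M * n ^ 2)))) *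
          fourier (-(M * n ^ 2) : ℤ) (t : AddCircle P) else 0) +
        duhamelCoeff P M a n k *
          (fourier k (t : AddCircle P) - fourier (-(M * n ^ 2) : ℤ) (t : AddCircle P)) := by
  rw [duhamelCoeff]
  by_cases hk : k = -(M * n ^ 2)
  · subst hk
    simp only [neg_add_cancel, fourier_zero, if_true, zero_mul, add_zero,
      intervalIntegral.integral_const, sub_zero, Complex.real_smul, mul_one]
    ring
  · have hk' : k + M * n ^ 2 ≠ 0 := fun h => hk (eq_neg_of_add_eq_zero_left h)
    have hkC : ((k + M * n ^ 2 : ℤ) : ℂ) ≠ 0 := Int.cast_ne_zero.2 hk'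
    have hπ : (Real.pi : ℂ) ≠ 0 := Complex.ofReal_ne_zero.2 Real.pi_ne_zero
    have hsplit : fourier k (t : AddCircle P) =
        fourier (k + M * n ^ 2) (t : AddCircle P) *
          fourier (-(M * n ^ 2) : ℤ) (t : AddCircle P) := by
      rw [← fourier_add, add_neg_cancel_right]
    rw [if_neg hk, if_neg hk', integral_fourier_of_ne_zero hk', zero_add, hsplit]
    field_simp

theorem mul_integral_fourier_eq_modeCoeff {F : AddCircle P → ℂ} (hF : MemLp F 2 haarAddCircle)
    (n : ℕ) {t : ℝ} (ht : t ∈ Icc 0 P) :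
    2 * Complex.I * n * Real.pi * fourier (-(M * n ^ 2) : ℤ) (t : AddCircle P) *
        ∫ τ in (0 : ℝ)..t, fourier (M * n ^ 2 : ℤ) (τ : AddCircle P) * F τ =
      modeCoeff P M (fourierCoeff F) n t := by
  have hsum := (hasSum_fourierCoeff_mul_integral_fourier hF ht (M * n ^ 2)).mul_left
    (2 * Complex.I * n * Real.pi * fourier (-(M * n ^ 2) : ℤ) (t : AddCircle P))
  simp only [duhamel_term_eq] at hsum
  have htail := hsum.sub (hasSum_ite_eq (-(M * n ^ 2 : ℤ))
    (t * (2 * Complex.I * Real.pi * (n * fourierCoeff F (-(M * n ^ 2)))) *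
      fourier (-(M * n ^ 2) : ℤ) (t : AddCircle P)))
  simp only [add_sub_cancel_left] at htail
  rw [modeCoeff, htail.tsum_eq, add_sub_cancel]

variable {T : ℝ}

theorem boundaryCoeff_eq_modeCoeff (hPM : P = 2 * M / Real.pi) (hT : 0 < T) (hTP : 4 * T ≤ P)
    {h : ℝ → ℂ} (hm : Measurable h) (hh : eSobolevHalfNorm T h ≠ ∞) (n : ℕ) {t : ℝ}
    (ht : t ∈ Icc 0 T) :
    boundaryCoeff h n t = modeCoeff P M (fourierCoeff (h ∘ tent T P)) n t := by
  have hextend : ∫ τ in (0 : ℝ)..t, fourier (M * n ^ 2 : ℤ) (τ : AddCircle P) * h τ =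
      ∫ τ in (0 : ℝ)..t, fourier (M * n ^ 2 : ℤ) (τ : AddCircle P) * (h ∘ tent T P) τ := by
    refine intervalIntegral.integral_congr fun τ hτ => ?_
    rw [uIcc_of_le ht.1] at hτ
    simp only [Function.comp_apply, tent_coe hT hTP ⟨hτ.1, hτ.2.trans ht.2⟩]
  rw [boundaryCoeff_eq_fourier hPM, hextend]
  exact mul_integral_fourier_eq_modeCoeff (memLp_comp_tent hT hTP hm hh) n
    ⟨ht.1, by linarith [ht.2]⟩

theorem eSobolevHalfNorm_congr {h g : ℝ → ℂ} (hg : h =ᵐ[volume.restrict (Ioo 0 T)] g) :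
    eSobolevHalfNorm T h = eSobolevHalfNorm T g := by
  have hdiff : ∀ᵐ t ∂volume.restrict (Ioo 0 T), ∫⁻ s in Ioo 0 T, ‖h t - h s‖ₑ ^ 2 / ‖t - s‖ₑ ^ 2 =
      ∫⁻ s in Ioo 0 T, ‖g t - g s‖ₑ ^ 2 / ‖t - s‖ₑ ^ 2 := by
    filter_upwards [hg] with t ht
    refine lintegral_congr_ae (hg.mono fun s hs => ?_)
    simp only [ht, hs]
  rw [eSobolevHalfNorm, eSobolevHalfNorm, lintegral_congr_ae hdiff,
    lintegral_congr_ae (hg.mono fun t ht => congrArg (‖·‖ₑ ^ 2) ht)]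

theorem boundaryCoeff_congr {h g : ℝ → ℂ} (hg : h =ᵐ[volume.restrict (Ioo 0 T)] g) (n : ℕ)
    {t : ℝ} (ht : t ∈ Icc 0 T) : boundaryCoeff h n t = boundaryCoeff g n t := by
  have hg' : h =ᵐ[volume.restrict (Ioc 0 t)] g := by
    rw [← Measure.restrict_congr_set Ioo_ae_eq_Ioc]
    exact ae_restrict_of_ae_restrict_of_subset (Ioo_subset_Ioo_right ht.2) hg
  rw [boundaryCoeff, boundaryCoeff, intervalIntegral.integral_of_le ht.1,
    intervalIntegral.integral_of_le ht.1]
  congr 1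
  exact integral_congr_ae (hg'.mono fun τ hτ => congrArg (_ * ·) hτ)

end Expansion

section SineSeries

theorem integral_cos_int_mul_pi {k : ℤ} (hk : k ≠ 0) :
    ∫ x in (0 : ℝ)..1, Real.cos (k * Real.pi * x) = 0 := by
  have hkπ : (k : ℝ) * Real.pi ≠ 0 := mul_ne_zero (Int.cast_ne_zero.2 hk) Real.pi_ne_zero
  rw [intervalIntegral.integral_comp_mul_left _ hkπ, integral_cos, mul_one, mul_zero,
    Real.sin_int_mul_pi, Real.sin_zero, sub_zero, smul_zero]

theorem integral_sin_mul_sin_eq_zero {n m : ℕ} (h : n ≠ m) :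
    ∫ x in (0 : ℝ)..1, Real.sin (n * Real.pi * x) * Real.sin (m * Real.pi * x) = 0 := by
  have hprod (x : ℝ) : Real.sin (n * Real.pi * x) * Real.sin (m * Real.pi * x) =
      2⁻¹ * Real.cos ((n - m : ℤ) * Real.pi * x) - 2⁻¹ * Real.cos ((n + m : ℤ) * Real.pi * x) := by
    have := Real.two_mul_sin_mul_sin (n * Real.pi * x) (m * Real.pi * x)
    rw [← sub_mul, ← sub_mul, ← add_mul, ← add_mul] at this
    push_cast
    linarith
  simp only [hprod]
  rw [intervalIntegral.integral_sub (Continuous.intervalIntegrable (by fun_prop) _ _)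
    (Continuous.intervalIntegrable (by fun_prop) _ _), intervalIntegral.integral_const_mul,
    intervalIntegral.integral_const_mul, integral_cos_int_mul_pi (by omega),
    integral_cos_int_mul_pi (by omega), sub_self]

theorem coeFn_sineMode (n : ℕ) : sineMode n =ᵐ[volume.restrict (Ioo (0 : ℝ) 1)]
    fun x : ℝ => (Real.sin (n * Real.pi * x) : ℂ) :=
  (memLp_sineMode n).coeFn_toLp

theorem inner_sineMode_of_ne {n m : ℕ} (h : n ≠ m) : inner ℂ (sineMode n) (sineMode m) = 0 := by
  have hinner : ∀ᵐ x ∂(volume.restrict (Ioo (0 : ℝ) 1)), inner ℂ (sineMode n x) (sineMode m x) =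
      ((Real.sin (n * Real.pi * x) * Real.sin (m * Real.pi * x) : ℝ) : ℂ) := by
    filter_upwards [coeFn_sineMode n, coeFn_sineMode m] with x hn hm
    rw [hn, hm, RCLike.inner_apply', Complex.conj_ofReal, Complex.ofReal_mul]
  rw [L2.inner_def, integral_congr_ae hinner, integral_complex_ofReal,
    ← integral_Ioc_eq_integral_Ioo, ← intervalIntegral.integral_of_le zero_le_one,
    integral_sin_mul_sin_eq_zero h, Complex.ofReal_zero]

theorem norm_sineMode_le (n : ℕ) : ‖sineMode n‖ ≤ 1 := by
  rw [sineMode, Lp.norm_toLp]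
  refine ENNReal.toReal_le_of_le_ofReal zero_le_one ?_
  refine (eLpNorm_le_of_ae_bound (C := 1) (.of_forall fun x => ?_)).trans ?_
  · rw [Complex.norm_real]
    exact Real.abs_sin_le_one _
  · simp

variable {ι : Type*} {σ : ι → ℕ}

theorem norm_sum_smul_sineMode_sq_le (hσ : Function.Injective σ) (c : ι → ℂ) (s : Finset ι) :
    ‖∑ i ∈ s, c i • sineMode (σ i)‖ ^ 2 ≤ ∑ i ∈ s, ‖c i‖ ^ 2 := by
  classical
  induction s using Finset.induction_on with
  | empty => simp
  | insert i s hi ih =>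
    have horth : inner ℂ (c i • sineMode (σ i)) (∑ j ∈ s, c j • sineMode (σ j)) = 0 := by
      rw [inner_sum]
      refine Finset.sum_eq_zero fun j hj => ?_
      have hne : σ i ≠ σ j := fun h => hi (hσ h ▸ hj)
      rw [inner_smul_left, inner_smul_right, inner_sineMode_of_ne hne, mul_zero, mul_zero]
    have hterm : ‖c i • sineMode (σ i)‖ ≤ ‖c i‖ := by
      rw [norm_smul]
      exact mul_le_of_le_one_right (norm_nonneg _) (norm_sineMode_le _)
    rw [Finset.sum_insert hi, Finset.sum_insert hi, sq,
      norm_add_sq_eq_norm_sq_add_norm_sq_of_inner_eq_zero _ _ horth, ← sq, ← sq]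
    gcongr

theorem summable_smul_sineMode (hσ : Function.Injective σ) {c : ι → ℂ}
    (hc : ∑' i, ‖c i‖ₑ ^ 2 ≠ ∞) : Summable fun i => c i • sineMode (σ i) := by
  have hsq : Summable fun i => ‖c i‖ ^ 2 := Summable.of_enorm (by simpa [enorm_pow] using hc)
  rw [summable_iff_vanishing_norm] at hsq ⊢
  intro ε hε
  obtain ⟨s, hs⟩ := hsq (ε ^ 2) (by positivity)
  refine ⟨s, fun t ht => lt_of_pow_lt_pow_left₀ 2 hε.le ?_⟩
  exact (norm_sum_smul_sineMode_sq_le hσ c t).trans_lt ((le_abs_self _).trans_lt (hs t ht))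

theorem enorm_tsum_smul_sineMode_le (hσ : Function.Injective σ) {c : ι → ℂ}
    (hc : ∑' i, ‖c i‖ₑ ^ 2 ≠ ∞) :
    ‖∑' i, c i • sineMode (σ i)‖ₑ ≤ (∑' i, ‖c i‖ₑ ^ 2) ^ (1 / 2 : ℝ) := by
  refine le_rpow_half_of_sq_le ?_
  have hlim := (((ENNReal.continuous_pow 2).comp continuous_enorm).tendsto _).comp
    (summable_smul_sineMode hσ hc).hasSum
  refine le_of_tendsto hlim (.of_forall fun s => le_trans ?_ (ENNReal.sum_le_tsum s))
  simp only [Function.comp_apply, enorm_sq_eq_ofReal]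
  rw [← ENNReal.ofReal_sum_of_nonneg fun i _ => by positivity]
  exact ENNReal.ofReal_le_ofReal (norm_sum_smul_sineMode_sq_le hσ c s)

theorem coeFn_sum_smul_sineMode (s : Finset ℕ) (c : ℕ → ℂ) :
    (∑ n ∈ s, c n • sineMode n : L2Unit) =ᵐ[volume.restrict (Ioo (0 : ℝ) 1)]
      fun x => ∑ n ∈ s, c n * (Real.sin (n * Real.pi * x) : ℂ) := by
  have hsmul (n : ℕ) : (c n • sineMode n : L2Unit) =ᵐ[volume.restrict (Ioo (0 : ℝ) 1)]
      fun x => c n * (Real.sin (n * Real.pi * x) : ℂ) := by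
    filter_upwards [Lp.coeFn_smul (c n) (sineMode n), coeFn_sineMode n] with x hx hsin
    rw [hx, Pi.smul_apply, hsin, smul_eq_mul]
  filter_upwards [Lp.coeFn_fun_finsetSum s fun n => c n • sineMode n, ae_all_iff.2 hsmul]
    with x hsum hterm
  rw [hsum]
  exact Finset.sum_congr rfl fun n _ => hterm n

end SineSeries

section JointLimit

open Filter Topology

variable {α β E : Type*} [MeasurableSpace α] [MeasurableSpace β] [NormedAddCommGroup E]

theorem ae_tendsto_of_eLpNorm_sub_lt {μ : Measure α} {p : ℝ≥0∞} (hp : 1 ≤ p) [CompleteSpace E]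
    {f : ℕ → α → E} {g : α → E} (hf : ∀ j, AEStronglyMeasurable (f j) μ)
    (hg : AEStronglyMeasurable g μ) (hfg : ∀ j, eLpNorm (f j - g) p μ < 2⁻¹ ^ j) :
    ∀ᵐ x ∂μ, Tendsto (fun j => f j x) atTop (𝓝 (g x)) := by
  have hcauchy : ∀ N n m : ℕ, N ≤ n → N ≤ m →
      eLpNorm (f n - f m) p μ < 2 * 2⁻¹ ^ N := fun N n m hn hm => by
    rw [← sub_sub_sub_cancel_right (f n) (f m) g, two_mul]
    refine (eLpNorm_sub_le ((hf n).sub hg) ((hf m).sub hg) hp).trans_lt (ENNReal.add_lt_add ?_ ?_)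
    · exact (hfg n).trans_le (pow_le_pow_right_of_le_one' (by simp) hn)
    · exact (hfg m).trans_le (pow_le_pow_right_of_le_one' (by simp) hm)
  have hexists : ∀ᵐ x ∂μ, ∃ l, Tendsto (fun j => f j x) atTop (𝓝 l) := by
    refine Lp.ae_tendsto_of_cauchy_eLpNorm hf hp ?_ hcauchy
    rw [ENNReal.tsum_mul_left, ENNReal.tsum_geometric]
    simp [ENNReal.mul_eq_top]
  have hmeasure : TendstoInMeasure μ f atTop g := by
    refine tendstoInMeasure_of_tendsto_eLpNorm (zero_lt_one.trans_le hp).ne' hf hg ?_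
    exact tendsto_of_tendsto_of_tendsto_of_le_of_le tendsto_const_nhds
      (ENNReal.tendsto_pow_atTop_nhds_zero_of_lt_one (r := 2⁻¹) (by simp))
      (fun _ => zero_le) fun j => (hfg j).le
  obtain ⟨ns, hns, hsub⟩ := hmeasure.exists_seq_tendsto_ae
  filter_upwards [hexists, hsub] with x ⟨l, hl⟩ hx
  rwa [tendsto_nhds_unique hx (hl.comp hns.tendsto_atTop)]

theorem exists_joint_limit [CompleteSpace E] {μ : Measure α} {ν : Measure β} [SFinite μ]
    [SFinite ν] {p : ℝ≥0∞} {f : ℕ → α × β → E} (hf : ∀ j, StronglyMeasurable (f j))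
    {g : β → α → E} {S : Set β} (hS : ∀ᵐ b ∂ν, b ∈ S)
    (hlim : ∀ b ∈ S, ∀ᵐ x ∂μ, Tendsto (fun j => f j (x, b)) atTop (𝓝 (g b x))) {Q : ℝ≥0∞}
    (hQ : ∀ j, eLpNorm (f j) p (μ.prod ν) ≤ Q) :
    ∃ U : α × β → E, (∀ b ∈ S, ∀ᵐ x ∂μ, U (x, b) = g b x) ∧
      AEStronglyMeasurable U (μ.prod ν) ∧ eLpNorm U p (μ.prod ν) ≤ Q := by
  have hmeas : MeasurableSet {z : α × β | ∃ l, Tendsto (fun j => f j z) atTop (𝓝 l)} :=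
    StronglyMeasurable.measurableSet_exists_tendsto hf
  have hae : ∀ᵐ z ∂μ.prod ν, ∃ l, Tendsto (fun j => f j z) atTop (𝓝 l) := by
    rw [Measure.ae_prod_iff_ae_ae hmeas, Measure.ae_ae_comm hmeas]
    exact hS.mono fun b hb => (hlim b hb).mono fun x hx => ⟨_, hx⟩
  refine ⟨fun z => limUnder atTop fun j => f j z,
    fun b hb => (hlim b hb).mono fun x hx => hx.limUnder_eq,
    (StronglyMeasurable.limUnder hf).aestronglyMeasurable, ?_⟩
  refine (Lp.eLpNorm_lim_le_liminf_eLpNorm (fun j => (hf j).aestronglyMeasurable) _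
    (hae.mono fun z hz => tendsto_nhds_limUnder hz)).trans ?_
  exact liminf_le_of_frequently_le' (.of_forall hQ)

end JointLimit

section Series

open Filter Topology

variable {T : ℝ} {c : ℕ → ℝ → ℂ} {γ : ℕ → ℝ≥0∞}

theorem tsum_enorm_sq_shift_ne_top (hγ : ∑' n, γ n ^ 2 ≠ ∞) {d : ℕ → ℂ} (hd : ∀ n, ‖d n‖ₑ ≤ γ n)
    (N : ℕ) : ∑' n, ‖d (n + N)‖ₑ ^ 2 ≠ ∞ := by
  refine ne_top_of_le_ne_top hγ ?_
  calc ∑' n, ‖d (n + N)‖ₑ ^ 2 ≤ ∑' n, γ (n + N) ^ 2 := by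
        gcongr with n
        exact hd _
    _ ≤ ∑' n, γ n ^ 2 :=
        ENNReal.tsum_comp_le_tsum_of_injective (add_left_injective N) fun n => γ n ^ 2

theorem summable_smul_sineMode_of_le (hγ : ∑' n, γ n ^ 2 ≠ ∞) {d : ℕ → ℂ}
    (hd : ∀ n, ‖d n‖ₑ ≤ γ n) : Summable fun n => d n • sineMode n :=
  summable_smul_sineMode Function.injective_id (tsum_enorm_sq_shift_ne_top hγ hd 0)

theorem enorm_tsum_sub_sum_smul_sineMode_le (hγ : ∑' n, γ n ^ 2 ≠ ∞) {d : ℕ → ℂ}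
    (hd : ∀ n, ‖d n‖ₑ ≤ γ n) (N : ℕ) :
    ‖(∑' n, d n • sineMode n) - ∑ n ∈ Finset.range N, d n • sineMode n‖ₑ ≤
      (∑' n, γ (n + N) ^ 2) ^ (1 / 2 : ℝ) := by
  rw [← (summable_smul_sineMode_of_le hγ hd).sum_add_tsum_nat_add N, add_sub_cancel_left]
  refine (enorm_tsum_smul_sineMode_le (add_left_injective N)
    (tsum_enorm_sq_shift_ne_top hγ hd N)).trans ?_
  gcongr with n
  exact hd _

theorem enorm_tsum_smul_sineMode_le_of_le (hγ : ∑' n, γ n ^ 2 ≠ ∞) {d : ℕ → ℂ}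
    (hd : ∀ n, ‖d n‖ₑ ≤ γ n) :
    ‖∑' n, d n • sineMode n‖ₑ ≤ (∑' n, γ n ^ 2) ^ (1 / 2 : ℝ) := by
  simpa using enorm_tsum_sub_sum_smul_sineMode_le hγ hd 0

theorem tendsto_rpow_half_tsum_sq_add (hγ : ∑' n, γ n ^ 2 ≠ ∞) :
    Tendsto (fun N => (∑' n, γ (n + N) ^ 2) ^ (1 / 2 : ℝ)) atTop (𝓝 0) := by
  simpa using (ENNReal.tendsto_sum_nat_add _ hγ).ennrpow_const (1 / 2 : ℝ)

theorem continuousOn_tsum_smul_sineMode (hγ : ∑' n, γ n ^ 2 ≠ ∞) (hc : ∀ n, Continuous (c n))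
    {S : Set ℝ} (hb : ∀ t ∈ S, ∀ n, ‖c n t‖ₑ ≤ γ n) :
    ContinuousOn (fun t => ∑' n, c n t • sineMode n) S := by
  have huniform : TendstoUniformlyOn (fun N t => ∑ n ∈ Finset.range N, c n t • sineMode n)
      (fun t => ∑' n, c n t • sineMode n) atTop S := by
    rw [EMetric.tendstoUniformlyOn_iff]
    intro ε hε
    filter_upwards [(tendsto_rpow_half_tsum_sq_add hγ).eventually_lt_const hε] with N hN t ht
    rw [edist_eq_enorm_sub]
    exact (enorm_tsum_sub_sum_smul_sineMode_le hγ (hb t ht) N).trans_lt hN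
  exact huniform.continuousOn (.of_forall fun N =>
    (continuous_finsetSum _ fun n _ => (hc n).smul continuous_const).continuousOn)

theorem eLpNorm_sum_sub_tsum_smul_sineMode_le (hγ : ∑' n, γ n ^ 2 ≠ ∞) {d : ℕ → ℂ}
    (hd : ∀ n, ‖d n‖ₑ ≤ γ n) (N : ℕ) :
    eLpNorm ((fun x => ∑ n ∈ Finset.range N, d n * (Real.sin (n * Real.pi * x) : ℂ)) -
        ⇑(∑' n, d n • sineMode n : L2Unit)) 2 (volume.restrict (Ioo (0 : ℝ) 1)) ≤
      (∑' n, γ (n + N) ^ 2) ^ (1 / 2 : ℝ) := by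
  refine le_of_eq_of_le ?_ (enorm_tsum_sub_sum_smul_sineMode_le hγ hd N)
  rw [enorm_sub_rev, Lp.enorm_def]
  exact eLpNorm_congr_ae (((coeFn_sum_smul_sineMode _ d).symm.sub .rfl).trans
    (Lp.coeFn_sub _ _).symm)

theorem exists_joint_representative (hγ : ∑' n, γ n ^ 2 ≠ ∞) (hc : ∀ n, Continuous (c n))
    (hb : ∀ t ∈ Icc 0 T, ∀ n, ‖c n t‖ₑ ≤ γ n) {p Q : ℝ≥0∞}
    (hQ : ∀ s : Finset ℕ, eLpNorm (fun z : ℝ × ℝ => ∑ n ∈ s, c n z.2 *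
      (Real.sin (n * Real.pi * z.1) : ℂ)) p (volume.restrict (Ioo (0 : ℝ) 1 ×ˢ Ioo 0 T)) ≤ Q) :
    ∃ U : ℝ × ℝ → ℂ,
      (∀ t ∈ Icc 0 T, ∀ᵐ x ∂(volume.restrict (Ioo (0 : ℝ) 1)),
        U (x, t) = (∑' n, c n t • sineMode n : L2Unit) x) ∧
      AEStronglyMeasurable U (volume.restrict (Ioo (0 : ℝ) 1 ×ˢ Ioo 0 T)) ∧
      eLpNorm U p (volume.restrict (Ioo (0 : ℝ) 1 ×ˢ Ioo 0 T)) ≤ Q := by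
  obtain ⟨φ, -, hφ⟩ := Filter.extraction_forall_of_eventually fun j : ℕ =>
    (tendsto_rpow_half_tsum_sq_add hγ).eventually_lt_const
      (ENNReal.pow_pos (by simp : (0 : ℝ≥0∞) < 2⁻¹) j)
  have hcont (j : ℕ) : Continuous fun z : ℝ × ℝ =>
      ∑ n ∈ Finset.range (φ j), c n z.2 * (Real.sin (n * Real.pi * z.1) : ℂ) :=
    continuous_finsetSum _ fun n _ => ((hc n).comp continuous_snd).mul (by fun_prop)
  rw [Measure.volume_eq_prod, ← Measure.prod_restrict] at hQ ⊢
  refine exists_joint_limit (fun j => (hcont j).stronglyMeasurable)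
    ((ae_restrict_mem measurableSet_Ioo).mono fun _ ht => Ioo_subset_Icc_self ht)
    (fun t ht => ?_) fun j => hQ _
  refine ae_tendsto_of_eLpNorm_sub_lt one_le_two
    (fun j => ((hcont j).comp (.prodMk_left t)).aestronglyMeasurable)
    (Lp.aestronglyMeasurable _) fun j => ?_
  exact (eLpNorm_sum_sub_tsum_smul_sineMode_le hγ (hb t ht) (φ j)).trans_lt (hφ j)

end Series

section Bounds

variable {T : ℝ}

theorem exists_halfEnergy_le_and_boundaryCoeff_eq {P : ℝ} [Fact (0 < P)] {M : ℕ}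
    (hPM : P = 2 * M / Real.pi) (hT : 0 < T) (hTP : 4 * T ≤ P) :
    ∃ C : ℝ≥0, ∀ h : ℝ → ℂ, MemSobolevHalf T h → ∃ a : ℤ → ℂ,
      halfEnergy a ≤ C * eSobolevHalfNorm T h ^ 2 ∧
      ∀ n, ∀ t ∈ Icc 0 T, boundaryCoeff h n t = modeCoeff P M a n t := by
  obtain ⟨C, hC⟩ := exists_halfEnergy_comp_tent_le hT hTP
  refine ⟨C, fun h hh => ?_⟩
  obtain ⟨⟨g, hg, hhg⟩, hfinite⟩ := hh
  rw [eSobolevHalfNorm_congr hhg] at hfinite ⊢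
  refine ⟨fourierCoeff (g ∘ tent T P), hC g hg.measurable hfinite.ne, fun n t ht => ?_⟩
  rw [boundaryCoeff_congr hhg n ht]
  exact boundaryCoeff_eq_modeCoeff hPM hT hTP hg.measurable hfinite.ne n ht

theorem exists_boundaryCoeff_bounds (hT : 0 < T) :
    ∃ C : ℝ≥0, ∀ h : ℝ → ℂ, MemSobolevHalf T h → ∃ (c : ℕ → ℝ → ℂ) (γ : ℕ → ℝ≥0∞),
      (∀ n, Continuous (c n)) ∧
      (∀ n, ∀ t ∈ Icc 0 T, boundaryCoeff h n t = c n t) ∧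
      (∀ t ∈ Icc 0 T, ∀ n, ‖c n t‖ₑ ≤ γ n) ∧
      (∑' n, γ n ^ 2) ^ (1 / 2 : ℝ) ≤ C * eSobolevHalfNorm T h ∧
      ∀ s : Finset ℕ, eLpNorm (fun z : ℝ × ℝ => ∑ n ∈ s, c n z.2 *
        (Real.sin (n * Real.pi * z.1) : ℂ)) 4 (volume.restrict (Ioo (0 : ℝ) 1 ×ˢ Ioo 0 T)) ≤
        C * eSobolevHalfNorm T h := by
  obtain ⟨M, hMT⟩ := exists_nat_ge (2 * Real.pi * T)
  have hM : 0 < M := by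
    have : 0 < 2 * Real.pi * T := by positivity
    exact_mod_cast this.trans_le hMT
  obtain ⟨P, hPM⟩ : ∃ P, P = 2 * M / Real.pi := ⟨_, rfl⟩
  have hTP : 4 * T ≤ P := by
    rw [hPM, le_div_iff₀ Real.pi_pos]
    linarith
  have : Fact (0 < P) := ⟨by linarith⟩
  obtain ⟨C₁, hC₁⟩ := exists_halfEnergy_le_and_boundaryCoeff_eq hPM hT hTP
  obtain ⟨C₂, hC₂⟩ := exists_enorm_modeCoeff_le P hM
  obtain ⟨C₃, hC₃⟩ := exists_eLpNorm_sum_modeCoeff_le P hM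
  have hsqrt {A C : ℝ≥0∞} {N : ℝ≥0∞} (hA : A ≤ C * N ^ 2) :
      A ^ (1 / 2 : ℝ) ≤ C ^ (1 / 2 : ℝ) * N := by
    refine (ENNReal.rpow_le_rpow hA (by norm_num)).trans_eq ?_
    rw [ENNReal.mul_rpow_of_nonneg _ _ (by norm_num), ennreal_sq_rpow_half]
  refine ⟨((C₂ * C₁) ^ (1 / 2 : ℝ) + C₃ * C₁ ^ (1 / 2 : ℝ) : ℝ≥0∞).toNNReal, fun h hh => ?_⟩
  rw [ENNReal.coe_toNNReal (by finiteness)]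
  obtain ⟨a, ha, hcoeff⟩ := hC₁ h hh
  have hfinite : halfEnergy a ≠ ∞ := by
    have := hh.2.ne
    exact ne_top_of_le_ne_top (by finiteness) ha
  obtain ⟨γ, hb, hγ⟩ := hC₂ a
  refine ⟨modeCoeff P M a, γ, continuous_modeCoeff hM hfinite, hcoeff,
    fun t ht n => hb n t ⟨ht.1, by linarith [ht.2]⟩, ?_, fun s => ?_⟩
  · refine (hsqrt (hγ.trans ?_)).trans (mul_le_mul_left le_self_add _)
    rw [mul_assoc]
    gcongr
  · refine (eLpNorm_mono_measure _ (restrict_le_cellMeasure (by linarith))).trans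
      ((hC₃ a hfinite s).trans ?_)
    rw [add_mul, mul_assoc]
    exact le_add_left (mul_le_mul_right (hsqrt ha) _)

end Bounds

end

theorem proposition4p6 (T : ℝ) (hT : 0 < T) :
    ∃ C : ℝ≥0, ∀ h : ℝ → ℂ, MemSobolevHalf T h →
      -- the series defining `u_h(·,t)` converges in `L²(0,1)` for every `t ∈ [0,T]`
      (∀ t ∈ Icc 0 T, Summable fun n : ℕ => boundaryCoeff h n t • sineMode n) ∧
      -- `u_h ∈ C([0,T]; L²(0,1))`, with the bound on the supremum over `t`
      ContinuousOn (boundaryIntegral h) (Icc 0 T) ∧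
      (⨆ t ∈ Icc 0 T, ‖boundaryIntegral h t‖ₑ) ≤ C * eSobolevHalfNorm T h ∧
      -- `u_h`, as a function `U` of `(x,t)`, is in `L⁴((0,1) × (0,T))`, with the bound
      ∃ U : ℝ × ℝ → ℂ,
        (∀ t ∈ Icc 0 T, ∀ᵐ x ∂(volume.restrict (Ioo (0 : ℝ) 1)),
          U (x, t) = boundaryIntegral h t x) ∧
        MemLp U 4 (volume.restrict (Ioo (0 : ℝ) 1 ×ˢ Ioo 0 T)) ∧
        eLpNorm U 4 (volume.restrict (Ioo (0 : ℝ) 1 ×ˢ Ioo 0 T)) ≤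
          C * eSobolevHalfNorm T h := by
  obtain ⟨C, hC⟩ := exists_boundaryCoeff_bounds hT
  refine ⟨C, fun h hh => ?_⟩
  obtain ⟨c, γ, hc, hcoeff, hb, hγ, hL4⟩ := hC h hh
  have hfinite : C * eSobolevHalfNorm T h < ∞ := ENNReal.mul_lt_top ENNReal.coe_lt_top hh.2
  have hsum : ∑' n, γ n ^ 2 ≠ ∞ := fun htop => (hγ.trans_lt hfinite).ne (by simp [htop])
  have hseries : ∀ t ∈ Icc 0 T, boundaryIntegral h t = ∑' n, c n t • sineMode n :=
    fun t ht => tsum_congr fun n => by rw [hcoeff n t ht]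
  obtain ⟨U, hU, hUmeas, hUbound⟩ := exists_joint_representative hsum hc hb hL4
  refine ⟨fun t ht => ?_, (continuousOn_tsum_smul_sineMode hsum hc hb).congr hseries,
    iSup₂_le fun t ht => ?_, U, fun t ht => ?_, ⟨hUmeas, hUbound.trans_lt hfinite⟩, hUbound⟩
  · simp only [hcoeff _ t ht]
    exact summable_smul_sineMode_of_le hsum (hb t ht)
  · rw [hseries t ht]
    exact (enorm_tsum_smul_sineMode_le_of_le hsum (hb t ht)).trans hγ
  · rw [hseries t ht]
    exact hU t ht
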